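/- **Setting.** Let $\mathbb S^2\subset\mathbb R^3$ be the unit sphere with its surface measure (total mass $4\pi$), let $\{Y_{\ell,m}\}_{\ell\in\mathbb N,\,-\ell\le m\le \ell}$ be the standard orthonormal basis of real spherical harmonics of the real space $L^2(\mathbb S^2)$, and let $(f\otimes g)(u,v)=f(u)g(v)$. An *admissible operator* $\mathscr D$ of spectral growth $p\ge 0$ is $\mathscr D f=\sum_{\ell}D_\ell\sum_{|m|\le\ell}\langle f,Y_{\ell,m}\rangle Y_{\ell,m}$, where the $D_\ell$ are non-zero reals with $C_1(1+\ell)^p\le |D_\ell|\le C_2(1+\ell)^p$ for some constants $C_1,C_2>0$ and all $\ell\in\mathbb N$. The tensorial Sobolev space is $$\mathbb H_p=\Big\{g\in L^2(\mathbb S^2\times\mathbb S^2):\ \sum_{\ell,\ell'}\sum_{m,m'}(1+\ell(\ell+1))^p(1+\ell'(\ell'+1))^p\langle g,Y_{\ell,m}\otimes Y_{\ell',m'}\rangle^2<\infty\Big\},$$ and on it $(\mathscr D\otimes\mathscr D)g=\sum_{\ell,\ell'}\sum_{m,m'} D_\ell D_{\ell'}\langle g,Y_{\ell,m}\otimes Y_{\ell',m'}\rangle\,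 Y_{\ell,m}\otimes Y_{\ell',m'}$. The *zonal Green's kernel* of $\mathscr D^*\mathscr D$ is the continuous function $\psi_{\mathscr D^*\mathscr D}:[-1,1]\to\mathbb R$ such that, for every $u\in\mathbb S^2$, the function $v\mapsto\psi_{\mathscr D^*\mathscr D}(\langle u,v\rangle)$ equals $(\mathscr D^*\mathscr D)^{-1}\delta_u$ in the sense of distributions. **Theorem 4.2.** Let $\mathscr D$ be an admissible operator of spectral growth $p>1$, let $n\ge 1$ and $r_i\ge 1$ for $i=1,\dots,n$, let $w_{ij}\in\mathbb R$, let $u_{ij}\in\mathbb S^2$ ($1\le i\le n$, $1\le j\le r_i$) be pairwise distinct, and let $\eta>0$. Then every $g\in\mathbb H_p$ has a unique continuous representative (through which it is evaluated at points), the series of $(\mathscr D\otimes\mathscr D)g$ converges in $L^2$, the kernel $\psi_{\mathscr D^*\mathscr D}$ exists and is unique, and the following holds. 1. The problem $$\min_{g\in\mathbb H_p}\ \frac{(4\pi)^2}{n}\sum_{i=1}^n\frac1{r_i(r_i-1)}\sum_{1\le j\ne k\le r_i}\big(w_{ij}w_{ik}-g(u_{ij},u_{ik})\big)^2+\eta\,\|(\mathscr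 D\otimes\mathscr D)g\|^2_{L^2(\mathbb S^2\times\mathbb S^2)}$$ (terms with $r_i=1$ being $0$) has a unique solution $R_\eta\in\mathbb H_p$. 2. It has the form $$R_\eta=\sum_{i=1}^n\frac1{\sqrt{r_i(r_i-1)}}\sum_{1\le j\ne k\le r_i}\beta_{ijk}\,\psi_{\mathscr D^*\mathscr D}(\langle\cdot,u_{ij}\rangle)\otimes\psi_{\mathscr D^*\mathscr D}(\langle\cdot,u_{ik}\rangle)$$ for exactly one family $\boldsymbol\beta=(\beta_{ijk})$ indexed by the $L=\sum_i r_i(r_i-1)$ triples $(i,j,k)$ with $1\le i\le n$, $1\le j\neq k\le r_i$, namely $$\boldsymbol\beta=\Big(\mathbf H+\frac{\eta n}{(4\pi)^2}\mathbf I_L\Big)^{-1}\boldsymbol z,\qquad z_{(i,j,k)}=\frac{w_{ij}w_{ik}}{\sqrt{r_i(r_i-1)}},$$ $$H_{(i_1,j_1,k_1),(i_2,j_2,k_2)}=\frac{\psi_{\mathscr D^*\mathscr D}(\langle u_{i_1j_1},u_{i_2j_2}\rangle)\,\psi_{\mathscr D^*\mathscr D}(\langle u_{i_1k_1},u_{i_2k_2}\rangle)}{\sqrt{r_{i_1}(r_{i_1}-1)\,r_{i_2}(r_{i_2}-1)}},$$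 the matrix $\mathbf H+\frac{\eta n}{(4\pi)^2}\mathbf I_L$ being invertible. 3. $R_\eta(u,v)=R_\eta(v,u)$ for all $u,v\in\mathbb S^2$. -/

import Mathlib

open MeasureTheory Polynomial

noncomputable section

namespace SphereRep

/-! ### The sphere, its surface measure and real spherical harmonics -/

/-- The unit sphere of three-dimensional Euclidean space. -/
abbrev S2 : Type := Metric.sphere (0 : EuclideanSpace ℝ (Fin 3)) 1

/-- The surface measure of the sphere (total mass `4π`). -/
abbrev surf : Measure S2 := (volume : Measure (EuclideanSpace ℝ (Fin 3))).toSphere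

/-- Real square-integrable functions on the sphere. -/
abbrev L2S : Type := Lp ℝ 2 surf

/-- Real square-integrable functions on the product of two spheres. -/
abbrev L2SS : Type := Lp ℝ 2 (surf.prod surf)

/-- The Legendre polynomial of degree `l` (Rodrigues' formula). -/
def legendre (l : ℕ) : ℝ[X] :=
  C (1 / (2 ^ l * (l.factorial : ℝ))) * derivative^[l] ((X ^ 2 - 1) ^ l)

/-- The normalization `√((2l+1)/(4π) · (l-k)!/(l+k)!)`, used for `k ≤ l`. -/
def harmNorm (l k : ℕ) : ℝ :=
  Real.sqrt ((2 * l + 1) / (4 * Real.pi) * ((l - k).factorial / (l + k).factorial))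

/-- The azimuthal factor: on the sphere, with `(x, y) = sin θ (cos φ, sin φ)`, it is
`√2 (sin θ)^m cos (m φ)` for `m > 0`, `1` for `m = 0`, and `√2 (sin θ)^|m| sin (|m| φ)`
for `m < 0`. -/
def azimuth (m : ℤ) (x y : ℝ) : ℝ :=
  if m = 0 then 1
  else if 0 < m then Real.sqrt 2 * ((⟨x, y⟩ : ℂ) ^ m.natAbs).re
  else Real.sqrt 2 * ((⟨x, y⟩ : ℂ) ^ m.natAbs).im

lemma continuous_azimuth (m : ℤ) (f g : S2 → ℝ) (hf : Continuous f) (hg : Continuous g) :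
    Continuous fun u => azimuth m (f u) (g u) := by
  have h : Continuous fun u => (⟨f u, g u⟩ : ℂ) := by
    have : (fun u => (⟨f u, g u⟩ : ℂ)) = fun u => (f u : ℂ) + (g u : ℂ) * Complex.I := by
      funext u
      exact Complex.mk_eq_add_mul_I _ _
    rw [this]
    fun_prop
  unfold azimuth
  split_ifs
  · exact continuous_const
  · exact continuous_const.mul (Complex.continuous_re.comp (h.pow _))
  · exact continuous_const.mul (Complex.continuous_im.comp (h.pow _))

/-- The real spherical harmonic `Y_{l,m}`, `-l ≤ m ≤ l`, written in Cartesian coordinates; with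
`z = cos θ`, `(sin θ)^|m| P_l^{(|m|)}(cos θ)` is the associated Legendre function (without the
Condon-Shortley sign). -/
def sphHarm (l : ℕ) (m : ℤ) : C(S2, ℝ) where
  toFun u := harmNorm l m.natAbs * (derivative^[m.natAbs] (legendre l)).eval (u.1 2) *
    azimuth m (u.1 0) (u.1 1)
  continuous_toFun := by
    have h : ∀ i : Fin 3, Continuous fun u : S2 => u.1 i := fun i => by fun_prop
    exact (continuous_const.mul ((Polynomial.continuous _).comp (h 2))).mul
      (continuous_azimuth m _ _ (h 0) (h 1))

/-- The indices `(l, m)` with `l ∈ ℕ` and `-l ≤ m ≤ l`. -/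
abbrev HarmIdx : Type := {q : ℕ × ℤ // -(q.1 : ℤ) ≤ q.2 ∧ q.2 ≤ (q.1 : ℤ)}

/-- The degree `l` of the index `(l, m)`. -/
abbrev HarmIdx.deg (q : HarmIdx) : ℕ := q.1.1

/-- The tensor product `(f ⊗ g)(u, v) = f(u) g(v)`. -/
def tensor (f g : C(S2, ℝ)) : C(S2 × S2, ℝ) where
  toFun x := f x.1 * g x.2
  continuous_toFun := by fun_prop

/-- The class in `L²` of a continuous function on the sphere. -/
def clsS (f : C(S2, ℝ)) : L2S := ContinuousMap.toLp 2 surf ℝ f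

/-- The class in `L²` of a continuous function on the product of two spheres. -/
def clsSS (f : C(S2 × S2, ℝ)) : L2SS := ContinuousMap.toLp 2 (surf.prod surf) ℝ f

/-- `Y_{l,m}` as an element of `L²`. -/
def Y (q : HarmIdx) : L2S := clsS (sphHarm q.1.1 q.1.2)

/-- `Y_{l,m} ⊗ Y_{l',m'}` as an element of `L²`. -/
def YY (q : HarmIdx × HarmIdx) : L2SS :=
  clsSS (tensor (sphHarm q.1.1.1 q.1.1.2) (sphHarm q.2.1.1 q.2.1.2))

/-! ### Sobolev spaces -/

/-- The Sobolev space of order `p` on the sphere. -/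
def sobolevS (p : ℝ) : Set L2S :=
  {f | Summable fun q : HarmIdx =>
    (1 + (q.deg : ℝ) * (q.deg + 1)) ^ p * (inner ℝ f (Y q)) ^ 2}

/-- The tensorial Sobolev space of order `p`, the Hilbert tensor square of the Sobolev space of
order `p` on the sphere, as a subset of `L²` of the product. -/
def sobolevSS (p : ℝ) : Set L2SS :=
  {g | Summable fun q : HarmIdx × HarmIdx =>
    (1 + (q.1.deg : ℝ) * (q.1.deg + 1)) ^ p * (1 + (q.2.deg : ℝ) * (q.2.deg + 1)) ^ p *
      (inner ℝ g (YY q)) ^ 2}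

/-- The infinitely smooth functions on the sphere, as the intersection of all Sobolev spaces
(each member being represented by its continuous version). -/
def smoothS : Set C(S2, ℝ) := {f | ∀ q : ℝ, 0 ≤ q → clsS f ∈ sobolevS q}

open Classical in
/-- The continuous representative of a class in `L²` of the product, through which the class is
evaluated at points (and `0` when there is none). -/
def contRep (g : L2SS) : C(S2 × S2, ℝ) :=
  if h : ∃ c : C(S2 × S2, ℝ), clsSS c = g then h.choose else 0

/-! ### Admissible operators and their Green's kernels -/

/-- An admissible operator with spectral growth order `p`, given by its spherical Fourier
coefficients `D_l`. -/
structure AdmissibleOperator (p : ℝ) where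
  coeff : ℕ → ℝ
  order_nonneg : 0 ≤ p
  coeff_ne_zero : ∀ l, coeff l ≠ 0
  growth : ∃ C₁ C₂ : ℝ, 0 < C₁ ∧ 0 < C₂ ∧
    ∀ l : ℕ, C₁ * (1 + (l : ℝ)) ^ p ≤ |coeff l| ∧ |coeff l| ≤ C₂ * (1 + (l : ℝ)) ^ p

namespace AdmissibleOperator

variable {p q : ℝ}

/-- The action `f ↦ ∑_l D_l ∑_m ⟨f, Y_{l,m}⟩ Y_{l,m}`; the series converges in `L²` exactly on
the `f` with `∑ D_l² ⟨f, Y_{l,m}⟩² < ∞`, that is on the Sobolev space of order `p`. -/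
def op (D : AdmissibleOperator p) (f : L2S) : L2S :=
  ∑' k : HarmIdx, (D.coeff k.deg * inner ℝ f (Y k)) • Y k

/-- The terms of the series of `(D ⊗ D) g`: by `(D ⊗ D)(Y ⊗ Y') = D Y ⊗ D Y'`, the basis function
`Y_{l,m} ⊗ Y_{l',m'}` is multiplied by `D_l D_{l'}`. -/
def tensorTerm (D : AdmissibleOperator p) (g : L2SS) (k : HarmIdx × HarmIdx) : L2SS :=
  (D.coeff k.1.deg * D.coeff k.2.deg * inner ℝ g (YY k)) • YY k

/-- The action of `D ⊗ D`. -/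
def tensorOp (D : AdmissibleOperator p) (g : L2SS) : L2SS := ∑' k, D.tensorTerm g k

/-- The adjoint, whose spherical Fourier coefficients are the conjugates of those of `D`. -/
def adjoint (D : AdmissibleOperator p) : AdmissibleOperator p where
  coeff l := star (D.coeff l)
  order_nonneg := D.order_nonneg
  coeff_ne_zero l := by simpa using D.coeff_ne_zero l
  growth := by simpa using D.growth

/-- The composition `D E`. -/
def comp (D : AdmissibleOperator p) (E : AdmissibleOperator q) : AdmissibleOperator (p + q) where
  coeff l := D.coeff l * E.coeff l
  order_nonneg := add_nonneg D.order_nonneg E.order_nonneg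
  coeff_ne_zero l := mul_ne_zero (D.coeff_ne_zero l) (E.coeff_ne_zero l)
  growth := by
    obtain ⟨a₁, a₂, ha₁, ha₂, ha⟩ := D.growth
    obtain ⟨b₁, b₂, hb₁, hb₂, hb⟩ := E.growth
    refine ⟨a₁ * b₁, a₂ * b₂, mul_pos ha₁ hb₁, mul_pos ha₂ hb₂, fun l => ?_⟩
    have hl : (0 : ℝ) < 1 + (l : ℝ) := by positivity
    rw [abs_mul, Real.rpow_add hl]
    have h1 : (0 : ℝ) < (1 + (l : ℝ)) ^ p := Real.rpow_pos_of_pos hl p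
    have h2 : (0 : ℝ) < (1 + (l : ℝ)) ^ q := Real.rpow_pos_of_pos hl q
    constructor
    · calc a₁ * b₁ * ((1 + (l : ℝ)) ^ p * (1 + (l : ℝ)) ^ q)
          = (a₁ * (1 + (l : ℝ)) ^ p) * (b₁ * (1 + (l : ℝ)) ^ q) := by ring
        _ ≤ |D.coeff l| * |E.coeff l| :=
          mul_le_mul (ha l).1 (hb l).1 (by positivity) (abs_nonneg _)
    · calc |D.coeff l| * |E.coeff l|
          ≤ (a₂ * (1 + (l : ℝ)) ^ p) * (b₂ * (1 + (l : ℝ)) ^ q) :=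
          mul_le_mul (ha l).2 (hb l).2 (abs_nonneg _) (by positivity)
        _ = a₂ * b₂ * ((1 + (l : ℝ)) ^ p * (1 + (l : ℝ)) ^ q) := by ring

end AdmissibleOperator

/-- The inner product of two points of the sphere, as a point of `[-1, 1]`. -/
def dot (u v : S2) : Set.Icc (-1 : ℝ) 1 :=
  ⟨inner ℝ (u : EuclideanSpace ℝ (Fin 3)) v, by
    have h := abs_real_inner_le_norm (u : EuclideanSpace ℝ (Fin 3)) v
    have hu : ‖(u : EuclideanSpace ℝ (Fin 3))‖ = 1 := by simp
    have hv : ‖(v : EuclideanSpace ℝ (Fin 3))‖ = 1 := by simp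
    rw [hu, hv, mul_one] at h
    exact abs_le.mp h⟩

/-- `ψ` is the (continuous) zonal Green's kernel of `E`: for every point `u`, the function
`v ↦ ψ ⟨u, v⟩` is `E⁻¹ δ_u` in the sense of distributions. The distribution `E⁻¹ δ_u` is the one
that maps `E φ` to `φ u`, for every smooth `φ`. -/
def IsZonalGreenKernel {p : ℝ} (E : AdmissibleOperator p) (ψ : C(Set.Icc (-1 : ℝ) 1, ℝ)) : Prop :=
  ∀ u : S2, ∀ φ ∈ smoothS, ∫ v, ψ (dot u v) * E.op (clsS φ) v ∂surf = φ u

/-! ### The regularized least-squares problem -/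

/-- The triples `(i, j, k)` with `j ≠ k` in `{1, …, r_i}`; they index the off-diagonal data. -/
abbrev OffDiag {n : ℕ} (r : Fin n → ℕ) : Type :=
  (i : Fin n) × {jk : Fin (r i) × Fin (r i) // jk.1 ≠ jk.2}

section Problem

variable {p : ℝ} (D : AdmissibleOperator p) {n : ℕ} (r : Fin n → ℕ) (η : ℝ)
  (w : (i : Fin n) → Fin (r i) → ℝ) (u : (i : Fin n) → Fin (r i) → S2)
  (ψ : C(Set.Icc (-1 : ℝ) 1, ℝ))

/-- The cost functional. -/
def cost (g : L2SS) : ℝ :=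
  (4 * Real.pi) ^ 2 / n *
      ∑ i : Fin n, 1 / ((r i : ℝ) * ((r i : ℝ) - 1)) *
        ∑ jk : {jk : Fin (r i) × Fin (r i) // jk.1 ≠ jk.2},
          (w i jk.1.1 * w i jk.1.2 - contRep g (u i jk.1.1, u i jk.1.2)) ^ 2 +
    η * ‖D.tensorOp g‖ ^ 2

/-- The factor `√(r_i (r_i - 1))` of the triple `(i, j, k)`. -/
def scale (a : OffDiag r) : ℝ := Real.sqrt ((r a.1 : ℝ) * ((r a.1 : ℝ) - 1))

/-- The vector of normalized observations `w_ij w_ik / √(r_i (r_i - 1))`. -/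
def obsVec (a : OffDiag r) : ℝ := w a.1 a.2.1.1 * w a.1 a.2.1.2 / scale r a

/-- The matrix `H`. -/
def gram : Matrix (OffDiag r) (OffDiag r) ℝ := fun a b =>
  ψ (dot (u a.1 a.2.1.1) (u b.1 b.2.1.1)) * ψ (dot (u a.1 a.2.1.2) (u b.1 b.2.1.2)) /
    Real.sqrt ((r a.1 : ℝ) * ((r a.1 : ℝ) - 1) * (r b.1 : ℝ) * ((r b.1 : ℝ) - 1))

/-- The function
`∑_i 1/√(r_i (r_i - 1)) ∑_{j ≠ k} β_ijk ψ(⟨x, u_ij⟩) ψ(⟨y, u_ik⟩)` of the point `(x, y)`. -/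
def splineForm (β : OffDiag r → ℝ) (x y : S2) : ℝ :=
  ∑ i : Fin n, 1 / Real.sqrt ((r i : ℝ) * ((r i : ℝ) - 1)) *
    ∑ jk : {jk : Fin (r i) × Fin (r i) // jk.1 ≠ jk.2},
      β ⟨i, jk⟩ * (ψ (dot x (u i jk.1.1)) * ψ (dot y (u i jk.1.2)))

end Problem

end SphereRep

end

/-!
The problem is ridge regression in a reproducing kernel Hilbert space.

Since the operator `D ⊗ D` is diagonal with non-zero eigenvalues `D_l D_{l'}` in the Hilbert basis
`Y ⊗ Y'`, it maps the tensorial Sobolev space bijectively onto `L²` (`tensorOp_tensorInv`,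
`tensorInv_tensorOp`). Under this bijection, point evaluation at `x` becomes the inner product
with a vector `Φ_x` (`contRep_tensorInv`), and `⟨Φ_x, Φ_y⟩ = ψ ⟨x₁, y₁⟩ ψ ⟨x₂, y₂⟩`
(`inner_feature`). The cost becomes `c ∑ (z_a - ⟨h, φ_a⟩)² + η ‖h‖²` for finitely many vectors `φ_a`
with Gram matrix `H` (`cost_tensorInv`, `gram_eq`). With `β` the solution of the normal equations,
the cost at `h` exceeds the cost at `∑ β_a φ_a` by `c ∑ ⟨h - ∑ β φ, φ_a⟩² + η ‖h - ∑ β φ‖²`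
(`ridge_identity`), which gives the minimizer and its uniqueness. The coefficients are unique
because evaluations at distinct points are linearly independent on the products of spherical harmonics
(`eq_zero_of_sum_harm₂`), and the solution is symmetric because the linear system is invariant
under the exchange of `j` and `k` (`coeff_swap`).

What has to be known about the sphere is the following.

* The `Y_{l,m}` are orthonormal (`integral_sphHarm_mul`). Rotations about the vertical axis reduce
  this to integrals of polynomials in the height, hence, by Archimedes' theorem (`integral_height`,
  obtained from Gaussian integrals in polar coordinates), to integrals over `[-1, 1]`, which
  the differential equation of the Legendre polynomials evaluates (`legGram_self`).
* The `Y_{l,m}` with `l ≤ d` span the polynomial functions of degree at most `d`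
  (`harmSpan_eq_pow`). By the Stone-Weierstrass theorem, the `Y` and the `Y ⊗ Y'` have dense span
  among the continuous functions, and so are Hilbert bases of `L²`.
* The kernel `∑_m Y_{l,m}(u) Y_{l,m}(v)` is a polynomial `p_l` of `⟨u, v⟩` (`zonal_eq`), since
  the reproducing kernel of the rotation-invariant space of polynomial functions of degree at
  most `d` is rotation-invariant; it is bounded by its diagonal value `(2l + 1) / 4π` (`abs_zonal_le`).

For `p > 1` the series `∑ D_l⁻² (2l + 1)` converges. Hence `ψ(t) = ∑ D_l⁻² p_l(t)` defines
a continuous function, and the Cauchy-Schwarz inequality makes the Fourier series of functions in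
the Sobolev spaces converge uniformly (`summable_smul_of_weighted`).
-/

noncomputable section

namespace SphereRep

/-! ### Legendre polynomials and their derivatives -/

/-- The integral over `[-1, 1]`, as a linear functional on polynomials. -/
def polyInt : ℝ[X] →ₗ[ℝ] ℝ where
  toFun Q := ∫ t in (-1 : ℝ)..1, Q.eval t
  map_add' P Q := by
    simp only [eval_add]
    exact intervalIntegral.integral_add (P.continuous.intervalIntegrable _ _)
      (Q.continuous.intervalIntegrable _ _)
  map_smul' c Q := by simp

lemma polyInt_apply (Q : ℝ[X]) : polyInt Q = ∫ t in (-1 : ℝ)..1, Q.eval t := rfl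

lemma polyInt_derivative (Q : ℝ[X]) : polyInt (derivative Q) = Q.eval 1 - Q.eval (-1) := by
  rw [polyInt_apply]
  exact intervalIntegral.integral_eq_sub_of_hasDerivAt (fun x _ => Q.hasDerivAt x)
    ((derivative Q).continuous.intervalIntegrable _ _)

lemma polyInt_C_mul (c : ℝ) (Q : ℝ[X]) : polyInt (C c * Q) = c * polyInt Q := by
  rw [← smul_eq_C_mul, map_smul, smul_eq_mul]

/-- The differential equation of the derivatives of `(X² - 1)^l`. -/
lemma iterate_derivative_sq_sub_one_ode (l k : ℕ) :
    (X ^ 2 - 1) * derivative^[k + 2] ((X ^ 2 - 1 : ℝ[X]) ^ l)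
      + C (2 * ((k : ℝ) + 1 - l)) * X * derivative^[k + 1] ((X ^ 2 - 1 : ℝ[X]) ^ l)
      + C (((k : ℝ) + 1) * k - 2 * l * (k + 1)) * derivative^[k] ((X ^ 2 - 1 : ℝ[X]) ^ l) = 0 := by
  induction k with
  | zero =>
    have h : (X ^ 2 - 1) * derivative ((X ^ 2 - 1 : ℝ[X]) ^ l)
        = C (2 * (l : ℝ)) * X * (X ^ 2 - 1) ^ l := by
      rcases l with _ | l
      · simp
      · simp only [derivative_pow, derivative_sub, derivative_X, derivative_one, Nat.add_sub_cancel,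
          map_mul, map_natCast, map_ofNat]
        push_cast
        ring
    have h' := congrArg derivative h
    simp only [derivative_mul, derivative_sub, derivative_X, derivative_one, derivative_C,
      derivative_X_pow] at h'
    simp only [Function.iterate_succ_apply', Function.iterate_zero, id_eq]
    simp only [map_mul, map_sub, map_add, map_natCast, map_ofNat, map_one,
      map_zero, Nat.cast_zero, Nat.cast_ofNat] at h' ⊢
    linear_combination h'
  | succ k ih =>
    have h' := congrArg derivative ih
    simp only [derivative_mul, derivative_add, derivative_sub, derivative_X, derivative_one,
      derivative_C, derivative_X_pow, derivative_zero, ← Function.iterate_succ_apply'] at h'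
    simp only [Nat.succ_eq_add_one, map_mul, map_sub, map_add, map_natCast, map_ofNat, map_one,
      Nat.cast_add, Nat.cast_one, Nat.cast_ofNat, add_assoc] at h' ⊢
    norm_num at h' ⊢
    linear_combination h'

/-- The derivatives of the Legendre polynomials (up to a power of `1 - X²`, the associated Legendre
functions) solve an eigenvalue problem in divergence form. -/
lemma legendre_ode (l m : ℕ) :
    derivative ((1 - X ^ 2) ^ (m + 1) * derivative^[m + 1] (legendre l))
      = C (-(((l : ℝ) - m) * (l + m + 1))) * ((1 - X ^ 2) ^ m * derivative^[m] (legendre l)) := by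
  have h := iterate_derivative_sq_sub_one_ode l (m + l)
  have key : ∀ j, derivative^[j] (legendre l) = C (1 / (2 ^ l * (l.factorial : ℝ))) *
      derivative^[j + l] ((X ^ 2 - 1) ^ l) := fun j => by
    rw [legendre, iterate_derivative_C_mul, ← Function.iterate_add_apply]
  rw [derivative_mul, ← Function.iterate_succ_apply' derivative, key, key, key, derivative_pow]
  simp only [derivative_sub, derivative_one, derivative_X_pow, Nat.add_sub_cancel]
  rw [show m + l + 2 = (m + 1).succ + l by omega, show m + l + 1 = m + 1 + l by omega] at h
  simp only [map_mul, map_sub, map_add, map_natCast, map_ofNat, map_one, map_neg,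
    Nat.cast_add, Nat.cast_one, Nat.cast_ofNat] at h ⊢
  linear_combination (-(1 - X ^ 2) ^ m * C (1 / (2 ^ l * (l.factorial : ℝ)))) * h

/-- The weighted `L²` inner product of `m`-th derivatives of two Legendre polynomials. -/
def legGram (m l l' : ℕ) : ℝ :=
  polyInt (derivative^[m] (legendre l) * derivative^[m] (legendre l') * (1 - X ^ 2) ^ m)

lemma legGram_comm (m l l' : ℕ) : legGram m l l' = legGram m l' l := by
  rw [legGram, legGram, mul_comm (derivative^[m] (legendre l))]

lemma legGram_succ (m l l' : ℕ) :
    legGram (m + 1) l l' = ((l : ℝ) - m) * (l + m + 1) * legGram m l l' := by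
  have h := polyInt_derivative
    (((1 - X ^ 2) ^ (m + 1) * derivative^[m + 1] (legendre l)) * derivative^[m] (legendre l'))
  rw [derivative_mul, legendre_ode, ← Function.iterate_succ_apply' derivative, map_add, mul_assoc,
    polyInt_C_mul] at h
  simp only [eval_mul, eval_pow, eval_sub, eval_one, eval_X, Nat.succ_eq_add_one, one_pow,
    even_two.neg_pow, sub_self, zero_pow (Nat.succ_ne_zero m), zero_mul] at h
  rw [legGram, legGram, show derivative^[m + 1] (legendre l) * derivative^[m + 1] (legendre l') *
      (1 - X ^ 2) ^ (m + 1) = (1 - X ^ 2) ^ (m + 1) * derivative^[m + 1] (legendre l) *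
      derivative^[m + 1] (legendre l') by ring, show derivative^[m] (legendre l) *
      derivative^[m] (legendre l') * (1 - X ^ 2) ^ m = (1 - X ^ 2) ^ m *
      derivative^[m] (legendre l) * derivative^[m] (legendre l') by ring]
  linarith

/-- Legendre polynomials of different degrees are orthogonal: by symmetry, `legGram_succ` computes
`legGram 1 l l'` with the two different eigenvalues `l (l + 1)` and `l' (l' + 1)`. -/
lemma legGram_of_ne {l l' : ℕ} (h : l ≠ l') (m : ℕ) : legGram m l l' = 0 := by
  induction m with
  | zero =>
    have h1 := legGram_succ 0 l l'
    have h2 := legGram_succ 0 l' l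
    rw [legGram_comm 1 l' l, legGram_comm 0 l' l, h1] at h2
    have h3 : ((l : ℝ) - l') * (l + l' + 1) * legGram 0 l l' = 0 := by
      push_cast at h2
      linear_combination h2
    have h4 : (l : ℝ) - l' ≠ 0 := sub_ne_zero.mpr (by exact_mod_cast h)
    have h5 : (l : ℝ) + l' + 1 ≠ 0 := by positivity
    simpa [h4, h5] using h3
  | succ m ih => rw [legGram_succ, ih, mul_zero]

lemma polyInt_one_sub_sq_pow (l : ℕ) :
    polyInt ((1 - X ^ 2) ^ l) * (2 * l + 1).factorial = 2 * (2 ^ l * (l.factorial : ℝ)) ^ 2 := by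
  induction l with
  | zero => norm_num [polyInt_apply]
  | succ l ih =>
    have h := polyInt_derivative (X * (1 - X ^ 2) ^ (l + 1))
    have h' : derivative (X * (1 - X ^ 2) ^ (l + 1) : ℝ[X])
        = C (2 * (l : ℝ) + 3) * (1 - X ^ 2) ^ (l + 1) - C (2 * ((l : ℝ) + 1)) * (1 - X ^ 2) ^ l := by
      simp only [derivative_mul, derivative_X, derivative_pow, derivative_sub, derivative_one,
        Nat.add_sub_cancel, map_mul, map_add, map_natCast, map_ofNat, map_one]
      push_cast
      ring
    rw [h', map_sub, polyInt_C_mul, polyInt_C_mul] at h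
    simp only [eval_mul, eval_pow, eval_sub, eval_one, eval_X] at h
    norm_num at h
    rw [show 2 * (l + 1) + 1 = (2 * l + 1) + 1 + 1 by ring, Nat.factorial_succ, Nat.factorial_succ,
      Nat.factorial_succ l]
    push_cast
    linear_combination ((2 * (l : ℝ) + 2) * ((2 * l + 1).factorial : ℝ)) * h
      + (2 * (l : ℝ) + 2) * (2 * (l + 1)) * ih

lemma natDegree_sq_sub_one_pow (l : ℕ) : ((X ^ 2 - 1 : ℝ[X]) ^ l).natDegree = 2 * l := by
  rw [natDegree_pow, show (1 : ℝ[X]) = C 1 by simp, natDegree_X_pow_sub_C, mul_comm]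

lemma coeff_sq_sub_one_pow (l : ℕ) : ((X ^ 2 - 1 : ℝ[X]) ^ l).coeff (2 * l) = 1 := by
  have h : ((X ^ 2 - 1 : ℝ[X]) ^ l).Monic := by
    apply Monic.pow
    rw [show (1 : ℝ[X]) = C 1 by simp]
    exact monic_X_pow_sub_C _ (by norm_num)
  have := h.coeff_natDegree
  rwa [natDegree_sq_sub_one_pow] at this

lemma iterate_derivative_legendre_self (l : ℕ) :
    derivative^[l] (legendre l)
      = C (((2 * l).factorial : ℝ) / (2 ^ l * (l.factorial : ℝ))) := by
  rw [legendre, iterate_derivative_C_mul, ← Function.iterate_add_apply, ← two_mul]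
  have h : (derivative^[2 * l] ((X ^ 2 - 1 : ℝ[X]) ^ l)).natDegree ≤ 0 := by
    refine (natDegree_iterate_derivative _ _).trans ?_
    rw [natDegree_sq_sub_one_pow, Nat.sub_self]
  rw [eq_C_of_natDegree_le_zero h, coeff_iterate_derivative, zero_add, coeff_sq_sub_one_pow,
    Nat.descFactorial_self, ← C_mul]
  congr 1
  simp
  ring

lemma natDegree_legendre (l : ℕ) : (legendre l).natDegree = l := by
  have h1 : (legendre l).natDegree ≤ l := by
    rw [legendre]
    refine (natDegree_C_mul_le _ _).trans ((natDegree_iterate_derivative _ _).trans ?_)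
    rw [natDegree_sq_sub_one_pow]
    omega
  refine le_antisymm h1 (not_lt.mp fun h => ?_)
  have h2 := iterate_derivative_eq_zero h
  rw [iterate_derivative_legendre_self, C_eq_zero] at h2
  have : ((2 * l).factorial : ℝ) / (2 ^ l * (l.factorial : ℝ)) ≠ 0 := by positivity
  exact this h2

lemma degree_iterate_derivative_legendre (m i : ℕ) :
    (derivative^[m] (legendre (m + i))).degree = i := by
  have h0 : derivative^[i] (derivative^[m] (legendre (m + i))) ≠ 0 := by
    rw [← Function.iterate_add_apply, add_comm i m, iterate_derivative_legendre_self, Ne, C_eq_zero]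
    positivity
  have h1 : derivative^[m] (legendre (m + i)) ≠ 0 := fun h => h0 (by rw [h, iterate_derivative_zero])
  rw [degree_eq_natDegree h1]
  congr 1
  refine le_antisymm ?_ (not_lt.mp fun h => h0 (iterate_derivative_eq_zero h))
  refine (natDegree_iterate_derivative _ _).trans ?_
  rw [natDegree_legendre]
  omega

lemma legGram_self_mul (m l : ℕ) (h : m ≤ l) :
    legGram m l l * (l - m).factorial = (l + m).factorial * legGram 0 l l := by
  induction m with
  | zero => simp [mul_comm]
  | succ m ih =>
    have ih := ih (by omega)
    rw [legGram_succ, ← add_assoc, Nat.factorial_succ]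
    rw [show l - m = (l - (m + 1)) + 1 by omega, Nat.factorial_succ] at ih
    have : ((l - (m + 1) : ℕ) : ℝ) = l - m - 1 := by
      rw [Nat.cast_sub h]; push_cast; ring
    push_cast at ih ⊢
    rw [this] at ih
    linear_combination ((l : ℝ) + m + 1) * ih

/-- The `l`-th derivative of the Legendre polynomial of degree `l` is a constant, so that
`legGram l l l` reduces to the integral of `(1 - X²)^l`. -/
lemma legGram_zero_self (l : ℕ) : legGram 0 l l = 2 / (2 * l + 1) := by
  have h1 := legGram_self_mul l l le_rfl
  have h2 := polyInt_one_sub_sq_pow l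
  rw [legGram, iterate_derivative_legendre_self, ← C_mul, polyInt_C_mul] at h1
  simp only [Nat.sub_self, Nat.factorial_zero, Nat.cast_one, mul_one, ← two_mul] at h1
  rw [Nat.factorial_succ] at h2
  have h3 : ((2 * l).factorial : ℝ) ≠ 0 := by positivity
  have h4 : (2 ^ l * (l.factorial : ℝ)) ≠ 0 := by positivity
  have h5 : (2 * (l : ℝ) + 1) ≠ 0 := by positivity
  push_cast at h2
  field_simp at h1 ⊢
  have h6 : (2 ^ l * (l.factorial : ℝ)) ^ 2 ≠ 0 := by positivity
  apply mul_left_cancel₀ h6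
  linear_combination -((2 * (l : ℝ) + 1)) * h1 + h2

/-- The norms of the associated Legendre functions. -/
lemma legGram_self (m l : ℕ) (h : m ≤ l) :
    legGram m l l = 2 / (2 * l + 1) * ((l + m).factorial / (l - m).factorial) := by
  have h1 := legGram_self_mul m l h
  rw [legGram_zero_self] at h1
  have : ((l - m).factorial : ℝ) ≠ 0 := by positivity
  rw [eq_comm, ← mul_div_assoc, div_eq_iff this, h1]
  ring

/-! ### Integration over the sphere -/

/-- Three-dimensional Euclidean space. -/
abbrev E3 : Type := EuclideanSpace ℝ (Fin 3)

/-- The action of a linear isometry of the space on the sphere. -/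
def rot (g : E3 ≃ₗᵢ[ℝ] E3) (u : S2) : S2 :=
  ⟨g u, by rw [mem_sphere_zero_iff_norm, g.norm_map, norm_eq_of_mem_sphere]⟩

@[simp] lemma coe_rot (g : E3 ≃ₗᵢ[ℝ] E3) (u : S2) : (rot g u : E3) = g u := rfl

lemma continuous_rot (g : E3 ≃ₗᵢ[ℝ] E3) : Continuous (rot g) :=
  (g.continuous.comp continuous_subtype_val).subtype_mk _

lemma rot_symm_rot (g : E3 ≃ₗᵢ[ℝ] E3) (u : S2) : rot g.symm (rot g u) = u :=
  Subtype.ext (by simp)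

lemma rot_rot_symm (g : E3 ≃ₗᵢ[ℝ] E3) (u : S2) : rot g (rot g.symm u) = u :=
  Subtype.ext (by simp)

lemma dot_rot (g : E3 ≃ₗᵢ[ℝ] E3) (u v : S2) : dot (rot g u) (rot g v) = dot u v :=
  Subtype.ext (g.inner_map_map _ _)

open scoped Pointwise in
lemma measurePreserving_rot (g : E3 ≃ₗᵢ[ℝ] E3) : MeasurePreserving (rot g) surf surf := by
  refine ⟨(continuous_rot g).measurable, Measure.ext fun s hs => ?_⟩
  have hm := (continuous_rot g).measurable hs
  rw [Measure.map_apply (continuous_rot g).measurable hs, Measure.toSphere_apply' _ hm,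
    Measure.toSphere_apply' _ hs]
  congr 1
  rw [← g.measurePreserving.measure_preimage_emb g.toHomeomorph.measurableEmbedding
    (Set.Ioo (0 : ℝ) 1 • (Subtype.val '' s))]
  congr 1
  ext x
  simp only [Set.mem_smul, Set.mem_image, Set.mem_preimage]
  constructor
  · rintro ⟨t, ht, -, ⟨v, hv, rfl⟩, rfl⟩
    exact ⟨t, ht, _, ⟨rot g v, hv, rfl⟩, by simp⟩
  · rintro ⟨t, ht, -, ⟨v, hv, rfl⟩, h⟩
    refine ⟨t, ht, _, ⟨rot g.symm v, ?_, rfl⟩, ?_⟩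
    · rwa [rot_rot_symm]
    · apply g.injective
      simpa using h

lemma measurableEmbedding_rot (g : E3 ≃ₗᵢ[ℝ] E3) : MeasurableEmbedding (rot g) :=
  (Homeomorph.mk ⟨rot g, rot g.symm, rot_symm_rot g, rot_rot_symm g⟩
    (continuous_rot g) (continuous_rot g.symm)).measurableEmbedding

lemma integral_comp_rot (g : E3 ≃ₗᵢ[ℝ] E3) (f : S2 → ℝ) :
    ∫ u, f (rot g u) ∂surf = ∫ u, f u ∂surf :=
  (measurePreserving_rot g).integral_comp (measurableEmbedding_rot g) f

/-- Polar coordinates for functions that are products of a radial and an angular factor. -/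
lemma integral_polar (F : E3 → ℝ) (f : S2 → ℝ) (ρ : ℝ → ℝ)
    (h : ∀ (u : S2) (t : ℝ), 0 < t → F (t • (u : E3)) = f u * ρ t) :
    ∫ x, F x = (∫ u, f u ∂surf) * ∫ t in Set.Ioi (0 : ℝ), t ^ 2 * ρ t := by
  have hmp := (volume : Measure E3).measurePreserving_homeomorphUnitSphereProd
  have hdim : Module.finrank ℝ E3 - 1 = 2 := by simp
  calc ∫ x, F x = ∫ x : ({(0)}ᶜ : Set E3), F x.1 ∂((volume : Measure E3).comap (↑)) := by
        rw [integral_subtype_comap (measurableSet_singleton _).compl F,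
          restrict_compl_singleton]
    _ = ∫ y, f y.1 * ρ y.2 ∂surf.prod (.volumeIoiPow (Module.finrank ℝ E3 - 1)) := by
        rw [← hmp.integral_comp (Homeomorph.measurableEmbedding _)]
        refine integral_congr_ae (.of_forall fun x => ?_)
        obtain ⟨⟨u, t⟩, rfl⟩ := (homeomorphUnitSphereProd E3).symm.surjective x
        simp only [Homeomorph.apply_symm_apply]
        exact h u t.1 t.2
    _ = (∫ u, f u ∂surf) * ∫ t : Set.Ioi (0 : ℝ), ρ t ∂.volumeIoiPow (Module.finrank ℝ E3 - 1) :=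
        integral_prod_mul f (fun t : Set.Ioi (0 : ℝ) => ρ t)
    _ = _ := by
        congr 1
        simp only [Measure.volumeIoiPow, ENNReal.ofReal, hdim]
        rw [integral_withDensity_eq_integral_smul,
          integral_subtype_comap measurableSet_Ioi fun a ↦ Real.toNNReal (a ^ 2) • ρ a,
          setIntegral_congr_fun measurableSet_Ioi fun x hx ↦ ?_]
        · rw [NNReal.smul_def, Real.coe_toNNReal _ (sq_nonneg _), smul_eq_mul]
        · exact (measurable_subtype_coe.pow_const _).real_toNNReal

lemma integral_Ioi_pow_mul_gaussian (k : ℕ) :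
    ∫ t in Set.Ioi (0 : ℝ), t ^ k * Real.exp (-t ^ 2) = 1 / 2 * Real.Gamma ((k + 1) / 2) := by
  have h := integral_rpow_mul_exp_neg_rpow (p := 2) (q := k) (by norm_num)
    (lt_of_lt_of_le (by norm_num) (Nat.cast_nonneg k))
  rw [← h]
  refine setIntegral_congr_fun measurableSet_Ioi fun x _ => ?_
  simp only [Real.rpow_natCast]
  norm_num

lemma integral_even_pow_mul_gaussian (k : ℕ) :
    ∫ t : ℝ, t ^ (2 * k) * Real.exp (-t ^ 2) = Real.Gamma (k + 1 / 2) := by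
  have h := integral_comp_abs (f := fun t : ℝ => t ^ (2 * k) * Real.exp (-t ^ 2))
  rw [integral_Ioi_pow_mul_gaussian] at h
  simp only [sq_abs, (even_two_mul k).pow_abs] at h
  rw [h]
  push_cast
  rw [show ((2 * (k : ℝ) + 1) / 2) = k + 1 / 2 by ring]
  ring

/-- Comparison of a Gaussian integral computed in Cartesian and in polar coordinates. -/
lemma integral_height_even_pow (k : ℕ) :
    ∫ u : S2, (u.1 2) ^ (2 * k) ∂surf = 4 * Real.pi / (2 * k + 1) := by
  have h1 := integral_polar (fun x => (x 2) ^ (2 * k) * Real.exp (-‖x‖ ^ 2))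
    (fun u => (u.1 2) ^ (2 * k)) (fun t => t ^ (2 * k) * Real.exp (-t ^ 2)) (fun u t ht => by
      simp only [PiLp.smul_apply, smul_eq_mul, norm_smul, Real.norm_eq_abs, abs_of_pos ht,
        norm_eq_of_mem_sphere, mul_one, mul_pow]
      ring)
  have h2 : ∫ x : E3, (x 2) ^ (2 * k) * Real.exp (-‖x‖ ^ 2) = Real.pi * Real.Gamma (k + 1 / 2) := by
    let f : Fin 3 → ℝ → ℝ := ![fun t => t ^ (2 * 0) * Real.exp (-t ^ 2),
      fun t => t ^ (2 * 0) * Real.exp (-t ^ 2), fun t => t ^ (2 * k) * Real.exp (-t ^ 2)]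
    rw [← (PiLp.volume_preserving_toLp (Fin 3)).integral_comp
      (MeasurableEquiv.toLp 2 (Fin 3 → ℝ)).measurableEmbedding]
    have : ∀ x : Fin 3 → ℝ, ((WithLp.toLp 2 x : E3) 2) ^ (2 * k) *
        Real.exp (-‖(WithLp.toLp 2 x : E3)‖ ^ 2) = ∏ i, f i (x i) := fun x => by
      rw [EuclideanSpace.norm_sq_eq, Fin.prod_univ_three, Fin.sum_univ_three]
      simp only [f, Real.norm_eq_abs, sq_abs, neg_add, Real.exp_add]
      simp
      ring
    simp only [this]
    rw [integral_fintype_prod_volume_eq_prod, Fin.prod_univ_three]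
    simp only [f, Matrix.cons_val]
    rw [integral_even_pow_mul_gaussian, integral_even_pow_mul_gaussian, Nat.cast_zero, zero_add,
      Real.Gamma_one_half_eq, Real.mul_self_sqrt Real.pi_pos.le]
  rw [h2] at h1
  have h3 : ∀ t : ℝ, t ^ 2 * (t ^ (2 * k) * Real.exp (-t ^ 2))
      = t ^ (2 * k + 2) * Real.exp (-t ^ 2) := fun t => by ring
  simp only [h3] at h1
  rw [integral_Ioi_pow_mul_gaussian] at h1
  push_cast at h1
  have hk : (k : ℝ) + 1 / 2 ≠ 0 := by positivity
  rw [show (2 * (k : ℝ) + 2 + 1) / 2 = k + 1 / 2 + 1 by ring, Real.Gamma_add_one hk] at h1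
  have hG : Real.Gamma (k + 1 / 2) ≠ 0 := (Real.Gamma_pos_of_pos (by positivity)).ne'
  rw [eq_div_iff (by positivity)]
  apply mul_right_cancel₀ hG
  linear_combination -4 * h1

/-- Archimedes' theorem: the height of a uniformly distributed point of the sphere is uniformly
distributed in `[-1, 1]`. -/
lemma integral_height (Q : ℝ[X]) :
    ∫ u : S2, Q.eval (u.1 2) ∂surf = 2 * Real.pi * polyInt Q := by
  have hint : ∀ Q : ℝ[X], Integrable (fun u : S2 => Q.eval (u.1 2)) surf := fun Q =>
    Continuous.integrable_of_hasCompactSupport (by fun_prop) (HasCompactSupport.of_compactSpace _)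
  induction Q using Polynomial.induction_on' with
  | add P Q hP hQ =>
    simp only [eval_add]
    rw [integral_add (hint P) (hint Q), hP, hQ, map_add, mul_add]
  | monomial n a =>
    simp only [eval_monomial, polyInt_apply, intervalIntegral.integral_const_mul,
      integral_const_mul, integral_pow]
    rcases Nat.even_or_odd' n with ⟨k, rfl | rfl⟩
    · rw [integral_height_even_pow, (Odd.neg_pow ⟨k, rfl⟩)]
      push_cast
      simp
      ring
    · have h := integral_comp_rot (LinearIsometryEquiv.neg ℝ) fun u => (u.1 2) ^ (2 * k + 1)
      have h' : ∀ u : S2, ((rot (LinearIsometryEquiv.neg ℝ) u).1 2) ^ (2 * k + 1)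
          = -(u.1 2) ^ (2 * k + 1) := fun u => by
        rw [coe_rot]
        simp [Odd.neg_pow ⟨k, rfl⟩]
      simp only [h', integral_neg] at h
      rw [show ∫ u : S2, (u.1 2) ^ (2 * k + 1) ∂surf = 0 by linarith,
        Even.neg_pow ⟨k + 1, by ring⟩]
      simp

/-! ### Orthonormality of the spherical harmonics -/

/-- The rotation of angle `θ` about the vertical axis, as a linear map. -/
def zRotLin (θ : ℝ) : E3 →ₗ[ℝ] E3 where
  toFun x := !₂[Real.cos θ * x 0 - Real.sin θ * x 1, Real.sin θ * x 0 + Real.cos θ * x 1, x 2]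
  map_add' x y := by
    ext i; fin_cases i <;> simp <;> ring
  map_smul' c x := by
    ext i; fin_cases i <;> simp <;> ring

/-- The rotation of angle `θ` about the vertical axis. -/
def zRot (θ : ℝ) : E3 ≃ₗᵢ[ℝ] E3 :=
  LinearIsometry.toLinearIsometryEquiv ⟨zRotLin θ, fun x => by
    rw [← sq_eq_sq₀ (norm_nonneg _) (norm_nonneg _), EuclideanSpace.norm_sq_eq,
      EuclideanSpace.norm_sq_eq, Fin.sum_univ_three, Fin.sum_univ_three]
    simp only [zRotLin, Real.norm_eq_abs, sq_abs]
    simp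
    linear_combination (x 0 ^ 2 + x 1 ^ 2) * Real.sin_sq_add_cos_sq θ⟩ rfl

lemma zRot_apply (θ : ℝ) (x : E3) : zRot θ x =
    !₂[Real.cos θ * x 0 - Real.sin θ * x 1, Real.sin θ * x 0 + Real.cos θ * x 1, x 2] := rfl

/-- The horizontal coordinates of a point, as a complex number. -/
def hor (u : S2) : ℂ := ⟨u.1 0, u.1 1⟩

lemma continuous_hor : Continuous hor := by
  have : hor = fun u : S2 => (u.1 0 : ℂ) + (u.1 1 : ℂ) * Complex.I := by
    funext u
    exact Complex.mk_eq_add_mul_I _ _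
  rw [this]
  fun_prop

lemma hor_rot_zRot (θ : ℝ) (u : S2) : hor (rot (zRot θ) u) = Complex.exp (θ * Complex.I) * hor u := by
  rw [Complex.exp_mul_I, ← Complex.ofReal_cos, ← Complex.ofReal_sin]
  apply Complex.ext <;> simp [hor, zRot_apply, -Complex.ofReal_cos, -Complex.ofReal_sin]
  ring

lemma height_rot_zRot (θ : ℝ) (u : S2) : (rot (zRot θ) u).1 2 = u.1 2 := by
  simp [zRot_apply]

lemma coord_sq_sum (u : S2) : u.1 0 ^ 2 + u.1 1 ^ 2 + u.1 2 ^ 2 = 1 := by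
  have h := EuclideanSpace.norm_sq_eq u.1
  rw [norm_eq_of_mem_sphere, Fin.sum_univ_three] at h
  simp only [Real.norm_eq_abs, sq_abs] at h
  linarith

lemma normSq_hor (u : S2) : Complex.normSq (hor u) = 1 - u.1 2 ^ 2 := by
  rw [hor, Complex.normSq_mk]
  linarith [coord_sq_sum u]

open ComplexConjugate in
/-- A rotation about the vertical axis changes the sign of the integrand when `a ≠ b`. -/
lemma integral_hor_pow_of_ne (Q : ℝ[X]) (c : ℂ) {a b : ℕ} (h : a ≠ b) :
    ∫ u : S2, Q.eval (u.1 2) * (c * hor u ^ a * conj (hor u) ^ b).re ∂surf = 0 := by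
  set θ : ℝ := Real.pi / ((a : ℝ) - b) with hθ
  have hab : (a : ℝ) - b ≠ 0 := sub_ne_zero.mpr (by exact_mod_cast h)
  have h1 := integral_comp_rot (zRot θ)
    fun u => Q.eval (u.1 2) * (c * hor u ^ a * conj (hor u) ^ b).re
  have h2 : ∀ u, c * hor (rot (zRot θ) u) ^ a * conj (hor (rot (zRot θ) u)) ^ b
      = -(c * hor u ^ a * conj (hor u) ^ b) := fun u => by
    rw [hor_rot_zRot, map_mul, ← Complex.exp_conj, mul_pow, mul_pow, ← Complex.exp_nat_mul,
      ← Complex.exp_nat_mul]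
    have h3 : Complex.exp (a * (θ * Complex.I)) * Complex.exp (b * conj (θ * Complex.I)) = -1 := by
      rw [← Complex.exp_add, ← Complex.exp_pi_mul_I]
      congr 1
      simp only [map_mul, Complex.conj_ofReal, Complex.conj_I]
      have h4 : ((a : ℂ) - b) * θ = Real.pi := by
        rw [hθ]
        push_cast
        have : (a : ℂ) - b ≠ 0 := by exact_mod_cast hab
        field_simp
      linear_combination Complex.I * h4
    linear_combination c * hor u ^ a * conj (hor u) ^ b * h3
  simp only [h2, height_rot_zRot, Complex.neg_re, mul_neg, integral_neg] at h1
  linarith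

/-- The constant `c` with `azimuth m x y = Re (c (x + iy)^|m|)`. -/
def azConst (m : ℤ) : ℂ :=
  if m = 0 then 1 else if 0 < m then Real.sqrt 2 else -(Real.sqrt 2 * Complex.I)

lemma azimuth_eq_re (m : ℤ) (u : S2) :
    azimuth m (u.1 0) (u.1 1) = (azConst m * hor u ^ m.natAbs).re := by
  unfold azimuth azConst hor
  split_ifs with h1 h2
  · simp [h1]
  · simp
  · simp

open ComplexConjugate in
lemma azimuth_mul_azimuth (m m' : ℤ) (u : S2) :
    azimuth m (u.1 0) (u.1 1) * azimuth m' (u.1 0) (u.1 1) =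
      (azConst m * azConst m' / 2 * hor u ^ (m.natAbs + m'.natAbs) * conj (hor u) ^ 0).re +
      (azConst m * conj (azConst m') / 2 * hor u ^ m.natAbs * conj (hor u) ^ m'.natAbs).re := by
  have h : ∀ z w : ℂ, z.re * w.re = (z * w / 2).re + (z * conj w / 2).re := fun z w => by
    simp
    ring
  rw [azimuth_eq_re, azimuth_eq_re, h]
  congr 2
  · ring
  · simp only [map_mul, map_pow]
    ring

lemma integrable_of_continuous {f : S2 → ℝ} (hf : Continuous f) : Integrable f surf :=
  Continuous.integrable_of_hasCompactSupport hf (HasCompactSupport.of_compactSpace _)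

open ComplexConjugate in
lemma azConst_mul_conj {m m' : ℤ} (h : m.natAbs = m'.natAbs) (hm : m ≠ 0) :
    (azConst m * conj (azConst m') / 2).re = if m = m' then 1 else 0 := by
  have hs : Real.sqrt 2 * Real.sqrt 2 = 2 := Real.mul_self_sqrt (by norm_num)
  rcases Int.natAbs_eq_natAbs_iff.mp h with rfl | rfl
  · rcases lt_or_gt_of_ne hm with h0 | h0
    · simp [azConst, hm, h0.not_gt, hs]
    · simp [azConst, hm, h0, hs]
  · have hm' : m' ≠ 0 := by simpa using hm
    have hne : ¬ (-m' = m') := by omega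
    rcases lt_or_gt_of_ne hm' with h0 | h0
    · simp [azConst, hm', h0, h0.not_gt, hne]
    · simp [azConst, hm', h0, h0.not_gt, hne]

open ComplexConjugate in
lemma integral_azimuth_mul (Q : ℝ[X]) (m m' : ℤ) :
    ∫ u : S2, Q.eval (u.1 2) * (azimuth m (u.1 0) (u.1 1) * azimuth m' (u.1 0) (u.1 1)) ∂surf =
      if m = m' then 2 * Real.pi * polyInt (Q * (1 - X ^ 2) ^ m.natAbs) else 0 := by
  have hz : Continuous fun u : S2 => Q.eval (u.1 2) := by fun_prop
  have hc : ∀ (c : ℂ) (a b : ℕ), Integrable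
      (fun u : S2 => Q.eval (u.1 2) * (c * hor u ^ a * conj (hor u) ^ b).re) surf :=
    fun c a b => integrable_of_continuous (hz.mul (Complex.continuous_re.comp
      ((continuous_const.mul (continuous_hor.pow a)).mul
        ((Complex.continuous_conj.comp continuous_hor).pow b))))
  simp only [azimuth_mul_azimuth, mul_add]
  rw [integral_add (hc _ _ _) (hc _ _ _)]
  by_cases h : m.natAbs = m'.natAbs
  · by_cases hm : m = 0
    · have hm' : m' = 0 := by simpa [hm] using h.symm
      subst hm hm'
      simp [azConst]
      rw [integral_mul_const, integral_height]
      ring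
    · rw [integral_hor_pow_of_ne Q _ (by omega : m.natAbs + m'.natAbs ≠ 0), zero_add]
      have h1 : ∀ u : S2, Q.eval (u.1 2) *
          (azConst m * conj (azConst m') / 2 * hor u ^ m.natAbs * conj (hor u) ^ m'.natAbs).re =
          (if m = m' then 1 else 0) * (Q * (1 - X ^ 2) ^ m.natAbs).eval (u.1 2) := fun u => by
        rw [← azConst_mul_conj h hm, ← h, mul_assoc _ (hor u ^ _), ← mul_pow, Complex.mul_conj,
          normSq_hor, ← Complex.ofReal_pow, Complex.re_mul_ofReal]
        simp only [eval_mul, eval_pow, eval_sub, eval_one, eval_X]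
        ring
      simp only [h1]
      rw [integral_const_mul, integral_height]
      split_ifs <;> simp
  · have hne : m ≠ m' := fun h' => h (by rw [h'])
    rw [integral_hor_pow_of_ne Q _ (by omega : m.natAbs + m'.natAbs ≠ 0),
      integral_hor_pow_of_ne Q _ h, if_neg hne, zero_add]

lemma sphHarm_apply (l : ℕ) (m : ℤ) (u : S2) : sphHarm l m u =
    harmNorm l m.natAbs * (derivative^[m.natAbs] (legendre l)).eval (u.1 2) *
      azimuth m (u.1 0) (u.1 1) := rfl

lemma integral_sphHarm_mul {l l' : ℕ} {m m' : ℤ} (hm : m.natAbs ≤ l) :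
    ∫ u, sphHarm l m u * sphHarm l' m' u ∂surf = if l = l' ∧ m = m' then 1 else 0 := by
  have h1 : ∀ u : S2, sphHarm l m u * sphHarm l' m' u =
      (C (harmNorm l m.natAbs * harmNorm l' m'.natAbs) * (derivative^[m.natAbs] (legendre l) *
        derivative^[m'.natAbs] (legendre l'))).eval (u.1 2) *
      (azimuth m (u.1 0) (u.1 1) * azimuth m' (u.1 0) (u.1 1)) := fun u => by
    rw [sphHarm_apply, sphHarm_apply]
    simp only [eval_mul, eval_C]
    ring
  simp only [h1]
  rw [integral_azimuth_mul]
  by_cases hmm : m = m'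
  · subst hmm
    rw [if_pos rfl, mul_assoc (C _), polyInt_C_mul]
    change _ * (_ * legGram m.natAbs l l') = _
    by_cases hll : l = l'
    · subst hll
      rw [legGram_self _ _ hm, if_pos ⟨rfl, rfl⟩, harmNorm, Real.mul_self_sqrt (by positivity)]
      have : (2 * (l : ℝ) + 1) ≠ 0 := by positivity
      have h2 : ((l - m.natAbs).factorial : ℝ) ≠ 0 := by positivity
      have h3 : ((l + m.natAbs).factorial : ℝ) ≠ 0 := by positivity
      have := Real.pi_ne_zero
      field_simp
      norm_num
    · rw [legGram_of_ne hll]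
      simp [hll]
  · simp [hmm]

/-! ### Spherical harmonics and polynomial functions -/

/-- A coordinate, as a continuous function on the sphere. -/
def coord (i : Fin 3) : C(S2, ℝ) := ⟨fun u => u.1 i, by fun_prop⟩

@[simp] lemma coord_apply (i : Fin 3) (u : S2) : coord i u = u.1 i := rfl

/-- The polynomial functions of degree at most one on the sphere. The power `affineFns ^ d` of this
submodule of `C(S2, ℝ)` consists of the polynomial functions of degree at most `d`. -/
def affineFns : Submodule ℝ C(S2, ℝ) := Submodule.span ℝ (insert 1 (Set.range coord))

lemma one_le_affineFns : 1 ≤ affineFns :=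
  Submodule.one_le.mpr (Submodule.subset_span (Set.mem_insert _ _))

lemma coord_mem_affineFns (i : Fin 3) : coord i ∈ affineFns :=
  Submodule.subset_span (Set.mem_insert_of_mem _ ⟨i, rfl⟩)

lemma affineFns_pow_mono {a b : ℕ} (h : a ≤ b) : affineFns ^ a ≤ affineFns ^ b :=
  pow_le_pow_right₀ one_le_affineFns h

/-- The span of the spherical harmonics of degree at most `d`. -/
def harmSpan (d : ℕ) : Submodule ℝ C(S2, ℝ) :=
  Submodule.span ℝ ((fun q : HarmIdx => sphHarm q.1.1 q.1.2) '' {q | q.deg ≤ d})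

lemma sphHarm_mem_harmSpan {l d : ℕ} {m : ℤ} (hm : m.natAbs ≤ l) (hl : l ≤ d) :
    sphHarm l m ∈ harmSpan d :=
  Submodule.subset_span ⟨⟨(l, m), by dsimp only; omega⟩, hl, rfl⟩

/-- The real part of `(x + iy)^n`. -/
def horRe (n : ℕ) : C(S2, ℝ) :=
  ⟨fun u => (hor u ^ n).re, Complex.continuous_re.comp (continuous_hor.pow n)⟩

/-- The imaginary part of `(x + iy)^n`. -/
def horIm (n : ℕ) : C(S2, ℝ) :=
  ⟨fun u => (hor u ^ n).im, Complex.continuous_im.comp (continuous_hor.pow n)⟩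

lemma horRe_zero : horRe 0 = 1 := by ext u; simp [horRe]

lemma horIm_zero : horIm 0 = 0 := by ext u; simp [horIm]

lemma horRe_succ (n : ℕ) : horRe (n + 1) = coord 0 * horRe n - coord 1 * horIm n := by
  ext u
  simp [horRe, horIm, pow_succ']
  simp [hor]

lemma horIm_succ (n : ℕ) : horIm (n + 1) = coord 0 * horIm n + coord 1 * horRe n := by
  ext u
  simp [horRe, horIm, pow_succ']
  simp [hor]

lemma coord_sq_add : coord 0 ^ 2 + coord 1 ^ 2 + coord 2 ^ 2 = 1 := by
  ext u
  simpa using coord_sq_sum u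

lemma horRe_horIm_mem (n : ℕ) : horRe n ∈ affineFns ^ n ∧ horIm n ∈ affineFns ^ n := by
  induction n with
  | zero =>
    rw [horRe_zero, horIm_zero, pow_zero]
    exact ⟨Submodule.one_le.mp le_rfl, Submodule.zero_mem _⟩
  | succ n ih =>
    rw [horRe_succ, horIm_succ, pow_succ']
    have h := fun i => coord_mem_affineFns i
    exact ⟨Submodule.sub_mem _ (Submodule.mul_mem_mul (h 0) ih.1) (Submodule.mul_mem_mul (h 1) ih.2),
      Submodule.add_mem _ (Submodule.mul_mem_mul (h 0) ih.2) (Submodule.mul_mem_mul (h 1) ih.1)⟩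

/-- The azimuthal factor, as a continuous function on the sphere. -/
def azFn (m : ℤ) : C(S2, ℝ) :=
  ⟨fun u => azimuth m (u.1 0) (u.1 1), continuous_azimuth m _ _ (by fun_prop) (by fun_prop)⟩

lemma azFn_zero : azFn 0 = 1 := by ext u; simp [azFn, azimuth]

lemma azFn_of_pos {n : ℕ} (hn : 0 < n) : azFn n = Real.sqrt 2 • horRe n := by
  ext u
  simp [azFn, azimuth, horRe, hor, hn.ne', hn]

lemma azFn_of_neg {n : ℕ} (hn : 0 < n) : azFn (-(n : ℤ)) = Real.sqrt 2 • horIm n := by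
  ext u
  simp [azFn, azimuth, horIm, hor, hn.ne']

lemma azFn_mem (m : ℤ) : azFn m ∈ affineFns ^ m.natAbs := by
  rcases Int.eq_nat_or_neg m with ⟨n, rfl | rfl⟩ <;> rcases Nat.eq_zero_or_pos n with rfl | hn
  · rw [Nat.cast_zero, azFn_zero, Int.natAbs_zero, pow_zero]
    exact Submodule.one_le.mp le_rfl
  · rw [azFn_of_pos hn, Int.natAbs_natCast]
    exact Submodule.smul_mem _ _ (horRe_horIm_mem n).1
  · rw [Nat.cast_zero, neg_zero, azFn_zero, Int.natAbs_zero, pow_zero]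
    exact Submodule.one_le.mp le_rfl
  · rw [azFn_of_neg hn, Int.natAbs_neg, Int.natAbs_natCast]
    exact Submodule.smul_mem _ _ (horRe_horIm_mem n).2

lemma aeval_coord_apply (i : Fin 3) (Q : ℝ[X]) (u : S2) : aeval (coord i) Q u = Q.eval (u.1 i) := by
  induction Q using Polynomial.induction_on' with
  | add P Q hP hQ => simp [hP, hQ]
  | monomial n a => simp [← C_mul_X_pow_eq_monomial]

lemma aeval_coord_mem (i : Fin 3) (Q : ℝ[X]) : aeval (coord i) Q ∈ affineFns ^ Q.natDegree := by
  rw [aeval_eq_sum_range]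
  refine Submodule.sum_mem _ fun k hk => Submodule.smul_mem _ _ ?_
  exact affineFns_pow_mono (Nat.lt_succ_iff.mp (Finset.mem_range.mp hk))
    (Submodule.pow_mem_pow _ (coord_mem_affineFns i) k)

lemma sphHarm_eq (l : ℕ) (m : ℤ) : sphHarm l m = harmNorm l m.natAbs •
    (aeval (coord 2) (derivative^[m.natAbs] (legendre l)) * azFn m) := by
  ext u
  rw [sphHarm_apply, ContinuousMap.smul_apply, ContinuousMap.mul_apply, aeval_coord_apply,
    smul_eq_mul, mul_assoc]
  rfl

lemma harmSpan_le_pow (d : ℕ) : harmSpan d ≤ affineFns ^ d := by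
  refine Submodule.span_le.mpr ?_
  rintro _ ⟨⟨⟨l, m⟩, hm⟩, hl, rfl⟩
  change l ≤ d at hl
  change sphHarm l m ∈ _
  dsimp only at hm
  rw [sphHarm_eq]
  refine Submodule.smul_mem _ _ ?_
  have h := Submodule.mul_mem_mul (aeval_coord_mem 2 (derivative^[m.natAbs] (legendre l)))
    (azFn_mem m)
  rw [← pow_add] at h
  refine affineFns_pow_mono ?_ h
  have := natDegree_iterate_derivative (legendre l) m.natAbs
  rw [natDegree_legendre] at this
  omega

lemma harmNorm_pos (l k : ℕ) : 0 < harmNorm l k := by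
  have := Real.pi_pos
  exact Real.sqrt_pos.mpr (by positivity)

/-- The `m`-th derivatives of the Legendre polynomials of degree `m, m + 1, …`. -/
def legSeq (m : ℕ) : Polynomial.Sequence ℝ :=
  ⟨fun i => derivative^[m] (legendre (m + i)), degree_iterate_derivative_legendre m⟩

lemma aeval_mul_azFn_mem {d : ℕ} {m : ℤ} (hm : m.natAbs ≤ d) (Q : ℝ[X])
    (hQ : Q.natDegree + m.natAbs ≤ d) : aeval (coord 2) Q * azFn m ∈ harmSpan d := by
  have h : Q ∈ Submodule.span ℝ (legSeq m.natAbs '' Set.Iio (d - m.natAbs + 1)) := by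
    rw [Polynomial.Sequence.span_degreeLT _ fun i _ =>
      (leadingCoeff_ne_zero.mpr ((legSeq m.natAbs).ne_zero i)).isUnit, Polynomial.mem_degreeLT]
    refine (degree_le_natDegree).trans_lt ?_
    exact_mod_cast (by omega : Q.natDegree < d - m.natAbs + 1)
  clear hQ
  induction h using Submodule.span_induction with
  | mem Q hQ =>
    obtain ⟨i, hi, rfl⟩ := hQ
    have hi : i < d - m.natAbs + 1 := hi
    have h1 := sphHarm_mem_harmSpan (l := m.natAbs + i) (d := d) (m := m) (by omega) (by omega)
    rw [sphHarm_eq] at h1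
    exact (Submodule.smul_mem_iff _ (harmNorm_pos _ _).ne').mp h1
  | zero => simp
  | add P Q _ _ hP hQ =>
    rw [map_add, add_mul]
    exact Submodule.add_mem _ hP hQ
  | smul c Q _ hQ =>
    rw [map_smul, smul_mul_assoc]
    exact Submodule.smul_mem _ _ hQ

/-- Products of a power of the height and of the real or the imaginary part of a power of
`x + iy`, of total degree at most `d`. -/
def cylSet (d : ℕ) : Set C(S2, ℝ) :=
  {f | ∃ k n : ℕ, k + n ≤ d ∧ (f = coord 2 ^ k * horRe n ∨ f = coord 2 ^ k * horIm n)}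

lemma cylSet_subset (d : ℕ) : cylSet d ⊆ harmSpan d := by
  have hs : Real.sqrt 2 ≠ 0 := by simp
  rintro f ⟨k, n, hkn, rfl | rfl⟩
  · rcases Nat.eq_zero_or_pos n with rfl | hn
    · have h := aeval_mul_azFn_mem (d := d) (m := 0) (by simp) (X ^ k) (by simpa using hkn)
      simpa [azFn_zero, horRe_zero] using h
    · have h := aeval_mul_azFn_mem (d := d) (m := n) (by simp; omega) (X ^ k) (by simpa using hkn)
      rw [azFn_of_pos hn, mul_smul_comm] at h
      simpa using (Submodule.smul_mem_iff _ hs).mp h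
  · rcases Nat.eq_zero_or_pos n with rfl | hn
    · simp [horIm_zero]
    · have h := aeval_mul_azFn_mem (d := d) (m := -n) (by simp; omega) (X ^ k) (by simpa using hkn)
      rw [azFn_of_neg hn, mul_smul_comm] at h
      simpa using (Submodule.smul_mem_iff _ hs).mp h

lemma cyl_mem {d k n : ℕ} (h : k + n ≤ d) : coord 2 ^ k * horRe n ∈ Submodule.span ℝ (cylSet d) ∧
    coord 2 ^ k * horIm n ∈ Submodule.span ℝ (cylSet d) :=
  ⟨Submodule.subset_span ⟨k, n, h, .inl rfl⟩, Submodule.subset_span ⟨k, n, h, .inr rfl⟩⟩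

/-- With `ζ = x + iy`, both `ζ · ζ^n` and `conj ζ · ζ^n = (1 - z²) ζ^(n - 1)` are combinations of
elements of `cylSet`, hence so are `x ζ^n` and `y ζ^n`. -/
lemma cyl_mul_coord_mem {d k n : ℕ} (h : k + n ≤ d) (i : Fin 3) :
    coord 2 ^ k * horRe n * coord i ∈ Submodule.span ℝ (cylSet (d + 1)) ∧
    coord 2 ^ k * horIm n * coord i ∈ Submodule.span ℝ (cylSet (d + 1)) := by
  have hz : coord 2 ^ k * horRe n * coord 2 ∈ Submodule.span ℝ (cylSet (d + 1)) ∧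
      coord 2 ^ k * horIm n * coord 2 ∈ Submodule.span ℝ (cylSet (d + 1)) := by
    have h1 := cyl_mem (d := d + 1) (k := k + 1) (n := n) (by omega)
    rwa [show coord 2 ^ (k + 1) * horRe n = coord 2 ^ k * horRe n * coord 2 by ring,
      show coord 2 ^ (k + 1) * horIm n = coord 2 ^ k * horIm n * coord 2 by ring] at h1
  have h0 := cyl_mem (d := d + 1) (k := k) (n := n + 1) (by omega)
  rcases n with _ | n
  · have e1 : horRe (0 + 1) = coord 0 := by rw [horRe_succ, horRe_zero, horIm_zero]; ring
    have e2 : horIm (0 + 1) = coord 1 := by rw [horIm_succ, horRe_zero, horIm_zero]; ring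
    rw [e1, e2] at h0
    rw [horRe_zero, horIm_zero, mul_one, mul_zero, zero_mul]
    rw [horRe_zero, mul_one] at hz
    refine ⟨?_, Submodule.zero_mem _⟩
    fin_cases i
    exacts [h0.1, h0.2, hz.1]
  · have h1 := cyl_mem (d := d + 1) (k := k) (n := n) (by omega)
    have h2 := cyl_mem (d := d + 1) (k := k + 2) (n := n) (by omega)
    rw [horRe_succ (n + 1), horIm_succ (n + 1)] at h0
    have c1 : coord 0 * horRe (n + 1) + coord 1 * horIm (n + 1) = (1 - coord 2 ^ 2) * horRe n := by
      rw [horRe_succ, horIm_succ]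
      linear_combination horRe n * coord_sq_add
    have c2 : coord 0 * horIm (n + 1) - coord 1 * horRe (n + 1) = (1 - coord 2 ^ 2) * horIm n := by
      rw [horRe_succ, horIm_succ]
      linear_combination horIm n * coord_sq_add
    have hR := Submodule.sub_mem _ h1.1 h2.1
    have hI := Submodule.sub_mem _ h1.2 h2.2
    have half : ∀ f : C(S2, ℝ), f + f ∈ Submodule.span ℝ (cylSet (d + 1)) →
        f ∈ Submodule.span ℝ (cylSet (d + 1)) := fun f hf => by
      rw [← two_smul ℝ f] at hf
      exact (Submodule.smul_mem_iff _ two_ne_zero).mp hf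
    obtain rfl | rfl | rfl : i = 0 ∨ i = 1 ∨ i = 2 := by fin_cases i <;> simp
    · constructor
      · refine half _ ?_
        convert Submodule.add_mem _ h0.1 hR using 1
        linear_combination coord 2 ^ k * c1
      · refine half _ ?_
        convert Submodule.add_mem _ h0.2 hI using 1
        linear_combination coord 2 ^ k * c2
    · constructor
      · refine half _ ?_
        convert Submodule.sub_mem _ h0.2 hI using 1
        linear_combination -coord 2 ^ k * c2
      · refine half _ ?_
        convert Submodule.sub_mem _ hR h0.1 using 1
        linear_combination coord 2 ^ k * c1
    · exact hz

lemma pow_le_span_cylSet (d : ℕ) : affineFns ^ d ≤ Submodule.span ℝ (cylSet d) := by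
  induction d with
  | zero =>
    rw [pow_zero, Submodule.one_le]
    have := (cyl_mem (d := 0) (k := 0) (n := 0) le_rfl).1
    rwa [horRe_zero, pow_zero, mul_one] at this
  | succ d ih =>
    rw [pow_succ]
    refine (mul_le_mul_left ih _).trans ?_
    rw [affineFns, Submodule.span_mul_span]
    refine Submodule.span_le.mpr ?_
    rintro _ ⟨_, ⟨k, n, hkn, hf⟩, _, rfl | ⟨i, rfl⟩, rfl⟩
    · have h1 := cyl_mem (d := d + 1) (k := k) (n := n) (by omega)
      rcases hf with rfl | rfl
      · simpa using h1.1
      · simpa using h1.2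
    · have h1 := cyl_mul_coord_mem hkn i
      rcases hf with rfl | rfl
      · exact h1.1
      · exact h1.2

/-- The spherical harmonics of degree at most `d` span the polynomial functions of degree at
most `d`. -/
lemma harmSpan_eq_pow (d : ℕ) : harmSpan d = affineFns ^ d :=
  le_antisymm (harmSpan_le_pow d)
    ((pow_le_span_cylSet d).trans (Submodule.span_le.mpr (cylSet_subset d)))

/-- Composition with a linear isometry, as an endomorphism of the algebra of continuous functions
on the sphere. -/
def compRot (g : E3 ≃ₗᵢ[ℝ] E3) : C(S2, ℝ) →ₐ[ℝ] C(S2, ℝ) :=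
  ContinuousMap.compRightAlgHom ℝ ℝ ⟨rot g, continuous_rot g⟩

@[simp] lemma compRot_apply (g : E3 ≃ₗᵢ[ℝ] E3) (f : C(S2, ℝ)) (u : S2) :
    compRot g f u = f (rot g u) := rfl

lemma compRot_mem_affineFns (g : E3 ≃ₗᵢ[ℝ] E3) :
    affineFns.map (compRot g).toLinearMap ≤ affineFns := by
  rw [affineFns, Submodule.map_span, Submodule.span_le]
  rintro _ ⟨f, rfl | ⟨i, rfl⟩, rfl⟩
  · exact Submodule.subset_span (Set.mem_insert _ _)
  · have h : (compRot g).toLinearMap (coord i)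
        = ∑ j, (g (EuclideanSpace.single j 1)) i • coord j := by
      ext u
      have hu : (u : E3) = ∑ j, u.1 j • EuclideanSpace.single j (1 : ℝ) := by
        ext k
        simp [Pi.single_apply]
      have h2 := congrArg (fun x : E3 => g x i) hu
      simp only [map_sum, map_smul] at h2
      simp only [AlgHom.toLinearMap_apply, compRot_apply, coord_apply, coe_rot]
      rw [h2]
      simp [mul_comm]
    rw [h]
    exact Submodule.sum_mem _ fun j _ => Submodule.smul_mem _ _ (coord_mem_affineFns j)

lemma compRot_mem_harmSpan (g : E3 ≃ₗᵢ[ℝ] E3) {d : ℕ} {f : C(S2, ℝ)} (hf : f ∈ harmSpan d) :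
    compRot g f ∈ harmSpan d := by
  rw [harmSpan_eq_pow] at hf ⊢
  have h : (affineFns ^ d).map (compRot g).toLinearMap ≤ affineFns ^ d := by
    rw [Submodule.map_pow]
    exact pow_le_pow_left' (compRot_mem_affineFns g) d
  exact h ⟨f, hf, rfl⟩

/-! ### The addition theorem -/

/-- The zonal kernel `∑_m Y_{l,m}(u) Y_{l,m}(v)`. -/
def zonal (l : ℕ) (u v : S2) : ℝ :=
  ∑ m ∈ Finset.Icc (-(l : ℤ)) l, sphHarm l m u * sphHarm l m v

/-- The reproducing kernel of the space of polynomial functions of degree at most `d`. -/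
def cumZonal (d : ℕ) (v : S2) : C(S2, ℝ) :=
  ∑ l ∈ Finset.range (d + 1), ∑ m ∈ Finset.Icc (-(l : ℤ)) l, sphHarm l m v • sphHarm l m

lemma cumZonal_apply (d : ℕ) (u v : S2) :
    cumZonal d v u = ∑ l ∈ Finset.range (d + 1), zonal l u v := by
  simp [cumZonal, zonal, ContinuousMap.sum_apply, mul_comm]

lemma cumZonal_mem (d : ℕ) (v : S2) : cumZonal d v ∈ harmSpan d := by
  refine Submodule.sum_mem _ fun l hl => Submodule.sum_mem _ fun m hm => Submodule.smul_mem _ _ ?_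
  rw [Finset.mem_range] at hl
  rw [Finset.mem_Icc] at hm
  exact sphHarm_mem_harmSpan (by omega) (by omega)

lemma integrable_mul (f g : C(S2, ℝ)) : Integrable (fun u => f u * g u) surf :=
  integrable_of_continuous (f.continuous.mul g.continuous)

lemma integral_mul_cumZonal {d : ℕ} {f : C(S2, ℝ)} (hf : f ∈ harmSpan d) (v : S2) :
    ∫ u, f u * cumZonal d v u ∂surf = f v := by
  induction hf using Submodule.span_induction with
  | mem f hf =>
    obtain ⟨⟨⟨l, m⟩, hm⟩, hl, rfl⟩ := hf
    dsimp only at hm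
    change l ≤ d at hl
    change ∫ u, sphHarm l m u * cumZonal d v u ∂surf = sphHarm l m v
    have h1 : ∀ u, sphHarm l m u * cumZonal d v u = ∑ l' ∈ Finset.range (d + 1),
        ∑ m' ∈ Finset.Icc (-(l' : ℤ)) l', sphHarm l' m' v * (sphHarm l m u * sphHarm l' m' u) := by
      intro u
      simp only [cumZonal, ContinuousMap.sum_apply, ContinuousMap.smul_apply, smul_eq_mul,
        Finset.mul_sum]
      exact Finset.sum_congr rfl fun _ _ => Finset.sum_congr rfl fun _ _ => by ring
    simp only [h1]
    rw [integral_finsetSum _ fun l' _ => integrable_finsetSum _ fun m' _ =>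
      (integrable_mul _ _).const_mul _]
    simp only [integral_finsetSum _ fun m' _ => (integrable_mul (sphHarm l m) _).const_mul _,
      integral_const_mul, integral_sphHarm_mul (by omega : m.natAbs ≤ l)]
    rw [Finset.sum_eq_single l, Finset.sum_eq_single m]
    · simp
    · intro m' _ h
      simp [Ne.symm h]
    · intro h
      exact absurd (Finset.mem_Icc.mpr hm) h
    · intro l' _ h
      simp [Ne.symm h]
    · intro h
      exact absurd (Finset.mem_range.mpr (by omega)) h
  | zero => simp
  | add f g _ _ hf hg =>
    simp only [ContinuousMap.add_apply, add_mul]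
    rw [integral_add (integrable_mul _ _) (integrable_mul _ _), hf, hg]
  | smul c f _ hf =>
    simp only [ContinuousMap.smul_apply, smul_eq_mul, mul_assoc]
    rw [integral_const_mul, hf]

lemma eq_zero_of_integral_sq {f : C(S2, ℝ)} (h : ∫ u, f u * f u ∂surf = 0) : f = 0 := by
  rw [integral_eq_zero_iff_of_nonneg (fun u => mul_self_nonneg _) (integrable_mul f f)] at h
  have h1 := (Continuous.ae_eq_iff_eq surf (f.continuous.mul f.continuous) continuous_const).mp h
  ext u
  exact mul_self_eq_zero.mp (congrFun h1 u)

/-- Composing with an isometry preserves the reproducing property, and a reproducing kernel is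
unique: the difference of the two candidates is orthogonal to itself. -/
lemma compRot_cumZonal (g : E3 ≃ₗᵢ[ℝ] E3) (d : ℕ) (v : S2) :
    compRot g (cumZonal d (rot g v)) = cumZonal d v := by
  set k := compRot g (cumZonal d (rot g v)) - cumZonal d v with hk
  have hkm : k ∈ harmSpan d := Submodule.sub_mem _
    (compRot_mem_harmSpan g (cumZonal_mem d _)) (cumZonal_mem d v)
  have h1 : ∫ u, k u * compRot g (cumZonal d (rot g v)) u ∂surf = k v := by
    have h2 := integral_comp_rot g fun u => compRot g.symm k u * cumZonal d (rot g v) u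
    simp only [compRot_apply, rot_symm_rot] at h2
    simp only [compRot_apply]
    rw [h2]
    have h3 := integral_mul_cumZonal (compRot_mem_harmSpan g.symm hkm) (rot g v)
    simpa only [compRot_apply, rot_symm_rot] using h3
  have h4 : ∫ u, k u * k u ∂surf = 0 := by
    have h5 : ∀ u, k u * k u
        = k u * compRot g (cumZonal d (rot g v)) u - k u * cumZonal d v u := fun u => by
      rw [← mul_sub, hk, ContinuousMap.sub_apply]
    simp only [h5]
    rw [integral_sub (integrable_mul _ _) (integrable_mul _ _), h1, integral_mul_cumZonal hkm,
      sub_self]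
  exact sub_eq_zero.mp (eq_zero_of_integral_sq h4)

lemma zonal_rot (g : E3 ≃ₗᵢ[ℝ] E3) (l : ℕ) (u v : S2) :
    zonal l (rot g u) (rot g v) = zonal l u v := by
  have h : ∀ d, ∑ l ∈ Finset.range (d + 1), zonal l (rot g u) (rot g v)
      = ∑ l ∈ Finset.range (d + 1), zonal l u v := fun d => by
    rw [← cumZonal_apply, ← cumZonal_apply, ← compRot_cumZonal g d v, compRot_apply]
  rcases l with _ | l
  · simpa using h 0
  · have h1 := h (l + 1)
    rwa [Finset.sum_range_succ _ (l + 1), h l, Finset.sum_range_succ _ (l + 1), add_right_inj] at h1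

/-- The north pole. -/
def pole : S2 := ⟨EuclideanSpace.single 2 1, by simp⟩

lemma exists_rot_eq_pole (v : S2) : ∃ g : E3 ≃ₗᵢ[ℝ] E3, rot g v = pole := by
  refine ⟨Submodule.reflection (ℝ ∙ ((v : E3) - (pole : E3)))ᗮ, Subtype.ext ?_⟩
  exact Submodule.reflection_sub (by simp)

lemma dot_pole (u : S2) : (dot u pole : ℝ) = u.1 2 := by
  simp [dot, pole, EuclideanSpace.inner_single_right]

/-- The polynomial `p_l` with `∑_m Y_{l,m}(u) Y_{l,m}(v) = p_l ⟨u, v⟩`. -/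
def zonalPoly (l : ℕ) : ℝ[X] := C (harmNorm l 0 ^ 2 * (legendre l).eval 1) * legendre l

lemma sphHarm_pole {l : ℕ} {m : ℤ} (hm : m ≠ 0) : sphHarm l m pole = 0 := by
  rw [sphHarm_apply, azimuth_eq_re]
  have h : hor pole = 0 := by apply Complex.ext <;> simp [hor, pole]
  rw [h, zero_pow (by simpa using hm)]
  simp

/-- The addition theorem for spherical harmonics. -/
lemma zonal_eq (l : ℕ) (u v : S2) : zonal l u v = (zonalPoly l).eval (dot u v : ℝ) := by
  obtain ⟨g, hg⟩ := exists_rot_eq_pole v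
  rw [← zonal_rot g, ← dot_rot g, hg, dot_pole, zonal, Finset.sum_eq_single 0]
  · rw [sphHarm_apply, sphHarm_apply, zonalPoly]
    simp [azimuth, pole]
    ring
  · intro m _ hm
    rw [sphHarm_pole hm, mul_zero]
  · intro h
    exact absurd (Finset.mem_Icc.mpr ⟨by simp, by simp⟩) h

lemma dot_self (u : S2) : (dot u u : ℝ) = 1 := by
  simp [dot]

lemma surf_univ : surf.real Set.univ = 4 * Real.pi := by
  have h := integral_height 1
  rw [polyInt_apply] at h
  simp only [eval_one, intervalIntegral.integral_const, integral_const, smul_eq_mul, mul_one] at h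
  rw [h]
  ring

/-- On the diagonal the zonal kernel is constant, and its integral is `2l + 1` by
orthonormality. -/
lemma zonal_self (l : ℕ) (u : S2) : zonal l u u = (2 * l + 1) / (4 * Real.pi) := by
  have h1 : ∫ v, zonal l v v ∂surf = 2 * l + 1 := by
    simp only [zonal]
    rw [integral_finsetSum _ fun m _ => integrable_mul _ _]
    have : ∀ m ∈ Finset.Icc (-(l : ℤ)) l, ∫ v, sphHarm l m v * sphHarm l m v ∂surf = 1 := by
      intro m hm
      rw [Finset.mem_Icc] at hm
      rw [integral_sphHarm_mul (by omega)]
      simp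
    rw [Finset.sum_congr rfl this, Finset.sum_const, Int.card_Icc, nsmul_eq_mul, mul_one]
    rw [show ((l : ℤ) + 1 - -(l : ℤ)).toNat = 2 * l + 1 by omega]
    push_cast
    rfl
  simp only [zonal_eq, dot_self] at h1 ⊢
  rw [integral_const, surf_univ, smul_eq_mul] at h1
  rw [eq_div_iff (by positivity), ← h1]
  ring

lemma abs_zonal_le (l : ℕ) (u v : S2) : |zonal l u v| ≤ (2 * l + 1) / (4 * Real.pi) := by
  refine abs_le_of_sq_le_sq ?_ (by positivity)
  calc zonal l u v ^ 2 ≤ (∑ m ∈ Finset.Icc (-(l : ℤ)) l, sphHarm l m u ^ 2) *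
        ∑ m ∈ Finset.Icc (-(l : ℤ)) l, sphHarm l m v ^ 2 :=
        Finset.sum_mul_sq_le_sq_mul_sq _ _ _
    _ = zonal l u u * zonal l v v := by simp only [zonal, sq]
    _ = _ := by rw [zonal_self, zonal_self, sq]

lemma exists_dot_eq (t : Set.Icc (-1 : ℝ) 1) : ∃ v : S2, dot v pole = t := by
  have ht : 0 ≤ 1 - t.1 ^ 2 := by nlinarith [t.2.1, t.2.2]
  refine ⟨⟨!₂[Real.sqrt (1 - t.1 ^ 2), 0, t.1], ?_⟩, Subtype.ext ?_⟩
  · rw [mem_sphere_zero_iff_norm, EuclideanSpace.norm_eq, Fin.sum_univ_three]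
    simp [Real.sq_sqrt ht]
  · rw [dot_pole]
    simp

/-! ### Density and Hilbert bases -/

/-- The algebra of polynomial functions on the sphere. -/
def polyFns : Subalgebra ℝ C(S2, ℝ) where
  carrier := {f | ∃ d, f ∈ affineFns ^ d}
  mul_mem' := by
    rintro f g ⟨a, ha⟩ ⟨b, hb⟩
    exact ⟨a + b, by rw [pow_add]; exact Submodule.mul_mem_mul ha hb⟩
  add_mem' := by
    rintro f g ⟨a, ha⟩ ⟨b, hb⟩
    exact ⟨max a b, Submodule.add_mem _ (affineFns_pow_mono (le_max_left _ _) ha)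
      (affineFns_pow_mono (le_max_right _ _) hb)⟩
  algebraMap_mem' c := ⟨0, by
    rw [pow_zero, Algebra.algebraMap_eq_smul_one]
    exact Submodule.smul_mem _ _ (Submodule.one_le.mp le_rfl)⟩

lemma coord_mem_polyFns (i : Fin 3) : coord i ∈ polyFns :=
  ⟨1, by rw [pow_one]; exact coord_mem_affineFns i⟩

lemma exists_coord_ne {u v : S2} (h : u ≠ v) : ∃ i, coord i u ≠ coord i v := by
  by_contra! hc
  exact h (Subtype.ext (PiLp.ext hc))

/-- The spherical harmonics, as a family of continuous functions. -/
def harm (q : HarmIdx) : C(S2, ℝ) := sphHarm q.1.1 q.1.2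

lemma mem_span_harm {f : C(S2, ℝ)} (hf : f ∈ polyFns) :
    f ∈ Submodule.span ℝ (Set.range harm) := by
  obtain ⟨d, hd⟩ := hf
  rw [← harmSpan_eq_pow] at hd
  exact Submodule.span_mono (Set.image_subset_range _ _) hd

lemma dense_of_separatesPoints {X : Type*} [TopologicalSpace X] [CompactSpace X]
    (A : Subalgebra ℝ C(X, ℝ)) (hA : A.SeparatesPoints) : Dense (A : Set C(X, ℝ)) := by
  intro f
  rw [← Subalgebra.topologicalClosure_coe,
    ContinuousMap.subalgebra_topologicalClosure_eq_top_of_separatesPoints A hA]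
  trivial

lemma dense_span_harm : Dense (Submodule.span ℝ (Set.range harm) : Set C(S2, ℝ)) := by
  refine (dense_of_separatesPoints polyFns fun u v huv => ?_).mono fun f hf => mem_span_harm hf
  obtain ⟨i, hi⟩ := exists_coord_ne huv
  exact ⟨_, ⟨coord i, coord_mem_polyFns i, rfl⟩, hi⟩

/-- The products of two spherical harmonics, as continuous functions on the product of two
spheres. -/
def harm₂ (k : HarmIdx × HarmIdx) : C(S2 × S2, ℝ) := tensor (harm k.1) (harm k.2)

@[simp] lemma tensor_apply (f g : C(S2, ℝ)) (x : S2 × S2) : tensor f g x = f x.1 * g x.2 := rfl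

lemma tensor_mul_tensor (f g f' g' : C(S2, ℝ)) :
    tensor f g * tensor f' g' = tensor (f * f') (g * g') := by
  ext x
  simp only [ContinuousMap.mul_apply, tensor_apply]
  ring

/-- The tensor product, as a bilinear map. -/
def tensorBilin : C(S2, ℝ) →ₗ[ℝ] C(S2, ℝ) →ₗ[ℝ] C(S2 × S2, ℝ) :=
  LinearMap.mk₂ ℝ tensor
    (fun f f' g => by ext x; simp [add_mul])
    (fun c f g => by ext x; simp [mul_assoc])
    (fun f g g' => by ext x; simp [mul_add])
    (fun c f g => by ext x; simp; ring)

lemma tensor_mem_span {f g : C(S2, ℝ)} (hf : f ∈ polyFns) (hg : g ∈ polyFns) :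
    tensor f g ∈ Submodule.span ℝ (Set.range harm₂) := by
  have h := Submodule.apply_mem_map₂ tensorBilin (mem_span_harm hf) (mem_span_harm hg)
  rw [Submodule.map₂_span_span] at h
  refine Submodule.span_mono ?_ h
  rintro _ ⟨_, ⟨q, rfl⟩, _, ⟨q', rfl⟩, rfl⟩
  exact ⟨(q, q'), rfl⟩

/-- The algebra generated by the products of two polynomial functions. -/
def polyFns₂ : Subalgebra ℝ C(S2 × S2, ℝ) :=
  (Submodule.span ℝ (Set.image2 tensor polyFns polyFns)).toSubalgebra
    (Submodule.subset_span ⟨1, polyFns.one_mem, 1, polyFns.one_mem, by ext; simp⟩)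
    (fun x y hx hy => by
      have h := Submodule.mul_mem_mul hx hy
      rw [Submodule.span_mul_span] at h
      refine Submodule.span_mono ?_ h
      rintro _ ⟨_, ⟨f, hf, g, hg, rfl⟩, _, ⟨f', hf', g', hg', rfl⟩, rfl⟩
      exact ⟨_, polyFns.mul_mem hf hf', _, polyFns.mul_mem hg hg', (tensor_mul_tensor _ _ _ _).symm⟩)

lemma dense_span_harm₂ : Dense (Submodule.span ℝ (Set.range harm₂) : Set C(S2 × S2, ℝ)) := by
  refine (dense_of_separatesPoints polyFns₂ fun x y hxy => ?_).mono fun f hf => ?_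
  · by_cases h : x.1 = y.1
    · obtain ⟨i, hi⟩ := exists_coord_ne fun h2 => hxy (Prod.ext h h2)
      refine ⟨_, ⟨tensor 1 (coord i), Submodule.subset_span
        ⟨1, polyFns.one_mem, _, coord_mem_polyFns i, rfl⟩, rfl⟩, ?_⟩
      simpa using hi
    · obtain ⟨i, hi⟩ := exists_coord_ne h
      refine ⟨_, ⟨tensor (coord i) 1, Submodule.subset_span
        ⟨_, coord_mem_polyFns i, 1, polyFns.one_mem, rfl⟩, rfl⟩, ?_⟩
      simpa using hi
  · have h : Submodule.span ℝ (Set.image2 tensor polyFns polyFns) ≤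
        Submodule.span ℝ (Set.range harm₂) := by
      refine Submodule.span_le.mpr ?_
      rintro _ ⟨f, hf, g, hg, rfl⟩
      exact tensor_mem_span hf hg
    exact h hf

lemma integral_harm_mul (q q' : HarmIdx) [Decidable (q = q')] :
    ∫ u, harm q u * harm q' u ∂surf = if q = q' then 1 else 0 := by
  obtain ⟨⟨l, m⟩, hm⟩ := q
  obtain ⟨⟨l', m'⟩, hm'⟩ := q'
  dsimp only at hm hm'
  simp only [harm]
  rw [integral_sphHarm_mul (by omega)]
  simp only [Subtype.mk.injEq, Prod.mk.injEq]

lemma inner_clsS (f g : C(S2, ℝ)) : inner ℝ (clsS f) (clsS g) = ∫ u, f u * g u ∂surf := by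
  rw [clsS, clsS, ContinuousMap.inner_toLp]
  simp [mul_comm]

lemma inner_clsSS (f g : C(S2 × S2, ℝ)) :
    inner ℝ (clsSS f) (clsSS g) = ∫ x, f x * g x ∂(surf.prod surf) := by
  rw [clsSS, clsSS, ContinuousMap.inner_toLp]
  simp [mul_comm]

lemma orthonormal_Y : Orthonormal ℝ Y := by
  classical
  rw [orthonormal_iff_ite]
  intro q q'
  change inner ℝ (clsS (harm q)) (clsS (harm q')) = _
  rw [inner_clsS, integral_harm_mul]

lemma orthonormal_YY : Orthonormal ℝ YY := by
  classical
  rw [orthonormal_iff_ite]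
  intro k k'
  change inner ℝ (clsSS (harm₂ k)) (clsSS (harm₂ k')) = _
  rw [inner_clsSS]
  have h : ∀ x, harm₂ k x * harm₂ k' x
      = (harm k.1 x.1 * harm k'.1 x.1) * (harm k.2 x.2 * harm k'.2 x.2) := fun x => by
    simp only [harm₂, tensor_apply]
    ring
  simp only [h]
  rw [integral_prod_mul (fun u => harm k.1 u * harm k'.1 u) (fun u => harm k.2 u * harm k'.2 u),
    integral_harm_mul, integral_harm_mul]
  simp only [Prod.ext_iff, ite_and, ite_mul, one_mul, zero_mul]

lemma dense_span_toLp {X ι : Type*} [TopologicalSpace X] [CompactSpace X] [T4Space X]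
    [MeasurableSpace X] [BorelSpace X] (ν : Measure X) [IsFiniteMeasure ν] [ν.WeaklyRegular]
    {e : ι → C(X, ℝ)} (he : Dense (Submodule.span ℝ (Set.range e) : Set C(X, ℝ))) :
    ⊤ ≤ (Submodule.span ℝ (Set.range fun i => ContinuousMap.toLp 2 ν ℝ (e i))).topologicalClosure := by
  have h := (ContinuousMap.toLp_denseRange ℝ ν ℝ (p := 2) (by simp)).dense_image
    (ContinuousMap.toLp 2 ν ℝ).continuous he
  rw [top_le_iff, ← Submodule.dense_iff_topologicalClosure_eq_top]
  convert h using 1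
  rw [Set.range_comp' (ContinuousMap.toLp 2 ν ℝ) e]
  exact congrArg _ (Submodule.map_span (ContinuousMap.toLp 2 ν ℝ).toLinearMap (Set.range e)).symm

lemma top_le_closure_span_Y : ⊤ ≤ (Submodule.span ℝ (Set.range Y)).topologicalClosure :=
  dense_span_toLp surf dense_span_harm

lemma top_le_closure_span_YY : ⊤ ≤ (Submodule.span ℝ (Set.range YY)).topologicalClosure :=
  dense_span_toLp (surf.prod surf) dense_span_harm₂

/-- The spherical harmonics, as a Hilbert basis of `L²` of the sphere. -/
def harmBasis : HilbertBasis HarmIdx ℝ L2S :=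
  HilbertBasis.mk orthonormal_Y top_le_closure_span_Y

/-- The products of two spherical harmonics, as a Hilbert basis of `L²` of the product. -/
def harmBasis₂ : HilbertBasis (HarmIdx × HarmIdx) ℝ L2SS :=
  HilbertBasis.mk orthonormal_YY top_le_closure_span_YY

@[simp] lemma harmBasis_apply (q : HarmIdx) : harmBasis q = Y q := by
  rw [harmBasis, HilbertBasis.coe_mk]

@[simp] lemma harmBasis₂_apply (k : HarmIdx × HarmIdx) : harmBasis₂ k = YY k := by
  rw [harmBasis₂, HilbertBasis.coe_mk]

/-! ### Series with respect to a Hilbert basis of continuous functions -/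

section Generic

variable {ι : Type*}

lemma exists_hasSum_smul_basis {E : Type*} [NormedAddCommGroup E] [InnerProductSpace ℝ E]
    (b : HilbertBasis ι ℝ E) (c : ι → ℝ) (hc : Summable fun i => c i ^ 2) :
    ∃ h : E, HasSum (fun i => c i • b i) h ∧ ∀ i, inner ℝ h (b i) = c i := by
  have hm : Memℓp c 2 := memℓp_gen (by simpa using hc)
  refine ⟨b.repr.symm ⟨c, hm⟩, b.hasSum_repr_symm ⟨c, hm⟩, fun i => ?_⟩
  rw [real_inner_comm, ← b.repr_apply_apply, LinearIsometryEquiv.apply_symm_apply]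

lemma hasSum_inner_basis_sq {E : Type*} [NormedAddCommGroup E] [InnerProductSpace ℝ E]
    (b : HilbertBasis ι ℝ E) (h : E) : HasSum (fun i => inner ℝ h (b i) ^ 2) (‖h‖ ^ 2) := by
  rw [← real_inner_self_eq_norm_sq]
  refine (b.hasSum_inner_mul_inner h h).congr_fun fun i => ?_
  rw [real_inner_comm, sq]

lemma ext_inner_basis {E : Type*} [NormedAddCommGroup E] [InnerProductSpace ℝ E]
    (b : HilbertBasis ι ℝ E) {g h : E} (hgh : ∀ i, inner ℝ g (b i) = inner ℝ h (b i)) : g = h := by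
  have h1 := hasSum_inner_basis_sq b (g - h)
  simp only [inner_sub_left, hgh, sub_self, ne_eq, OfNat.ofNat_ne_zero, not_false_eq_true,
    zero_pow] at h1
  have h2 := h1.unique hasSum_zero
  exact sub_eq_zero.mp (norm_eq_zero.mp (by simpa using h2))

variable {X : Type*} [TopologicalSpace X] [CompactSpace X]

/-- By the Cauchy-Schwarz inequality, a series of continuous functions with square-summable weighted
coefficients converges uniformly (and unconditionally) as soon as the reproducing kernel of the
weighted family is bounded on the diagonal. -/
lemma summable_smul_of_weighted {e : ι → C(X, ℝ)} {a μ : ι → ℝ} (hμ : ∀ i, μ i ≠ 0)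
    (ha : Summable fun i => (a i * μ i) ^ 2) {B : ℝ}
    (hB : ∀ x (s : Finset ι), ∑ i ∈ s, (e i x / μ i) ^ 2 ≤ B) :
    Summable fun i => a i • e i := by
  rw [summable_iff_vanishing_norm]
  intro ε hε
  have hB' : 0 < |B| + 1 := by positivity
  obtain ⟨s, hs⟩ := summable_iff_vanishing_norm.mp ha ((ε / 2) ^ 2 / (|B| + 1)) (by positivity)
  refine ⟨s, fun t ht => ?_⟩
  have h1 := hs t ht
  rw [Real.norm_of_nonneg (Finset.sum_nonneg fun i _ => sq_nonneg _)] at h1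
  refine lt_of_le_of_lt ((ContinuousMap.norm_le _ (by positivity)).mpr fun x => ?_) (half_lt_self hε)
  rw [ContinuousMap.sum_apply, Real.norm_eq_abs]
  refine abs_le_of_sq_le_sq ?_ (by positivity)
  calc (∑ i ∈ t, (a i • e i) x) ^ 2 = (∑ i ∈ t, (a i * μ i) * (e i x / μ i)) ^ 2 := by
        congr 1
        refine Finset.sum_congr rfl fun i _ => ?_
        have := hμ i
        rw [ContinuousMap.smul_apply, smul_eq_mul]
        field_simp
    _ ≤ (∑ i ∈ t, (a i * μ i) ^ 2) * ∑ i ∈ t, (e i x / μ i) ^ 2 :=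
        Finset.sum_mul_sq_le_sq_mul_sq _ _ _
    _ ≤ (ε / 2) ^ 2 / (|B| + 1) * (|B| + 1) :=
        mul_le_mul h1.le ((hB x t).trans ((le_abs_self B).trans (by linarith)))
          (Finset.sum_nonneg fun i _ => sq_nonneg _) (by positivity)
    _ = (ε / 2) ^ 2 := by field_simp

/-- Elements of a weighted Sobolev-type space have a continuous representative, the pointwise sum of
their Fourier series. -/
lemma exists_continuous_rep [T4Space X] [MeasurableSpace X] [BorelSpace X] {ν : Measure X}
    [IsFiniteMeasure ν] (b : HilbertBasis ι ℝ (Lp ℝ 2 ν)) {e : ι → C(X, ℝ)}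
    (hb : ∀ i, b i = ContinuousMap.toLp 2 ν ℝ (e i)) {μ : ι → ℝ} (hμ : ∀ i, μ i ≠ 0) {B : ℝ}
    (hB : ∀ x (s : Finset ι), ∑ i ∈ s, (e i x / μ i) ^ 2 ≤ B) {g : Lp ℝ 2 ν}
    (hg : Summable fun i => (inner ℝ g (b i) * μ i) ^ 2) :
    ∃ c : C(X, ℝ), ContinuousMap.toLp 2 ν ℝ c = g ∧
      ∀ x, HasSum (fun i => inner ℝ g (b i) * e i x) (c x) := by
  have hs := (summable_smul_of_weighted hμ hg hB).hasSum
  refine ⟨_, ?_, fun x => hs.mapL (ContinuousMap.evalCLM ℝ x)⟩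
  have h1 := hs.mapL (ContinuousMap.toLp 2 ν ℝ)
  simp only [map_smul, ← hb] at h1
  have h2 := b.hasSum_repr g
  simp only [b.repr_apply_apply, real_inner_comm g] at h2
  refine h1.unique (h2.congr_fun fun i => ?_)
  rw [real_inner_comm]

end Generic

/-! ### Sobolev spaces in terms of an admissible operator -/

section Sobolev

variable {p : ℝ}

lemma sobolev_weight_pos (l : ℕ) : 0 < (1 + (l : ℝ) * (l + 1)) ^ p :=
  Real.rpow_pos_of_pos (by positivity) p

/-- The weights of the Sobolev space of order `p` and the squares of the coefficients of an
admissible operator of order `p` are comparable, since `(1 + l)² / 2 ≤ 1 + l (l + 1) ≤ (1 + l)²`. -/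
lemma AdmissibleOperator.exists_sq_bounds (D : AdmissibleOperator p) :
    ∃ c₁ c₂ : ℝ, 0 < c₁ ∧ 0 < c₂ ∧ ∀ l : ℕ, (1 + (l : ℝ) * (l + 1)) ^ p ≤ c₁ * D.coeff l ^ 2 ∧
      D.coeff l ^ 2 ≤ c₂ * (1 + (l : ℝ) * (l + 1)) ^ p := by
  obtain ⟨C₁, C₂, h₁, h₂, h⟩ := D.growth
  refine ⟨(C₁ ^ 2)⁻¹, C₂ ^ 2 * 2 ^ p, by positivity, by positivity, fun l => ?_⟩
  have hl : (0 : ℝ) ≤ l := Nat.cast_nonneg l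
  have hp := D.order_nonneg
  have hsq : ((1 + (l : ℝ)) ^ p) ^ 2 = ((1 + (l : ℝ)) ^ 2) ^ p := by
    rw [← Real.rpow_natCast, ← Real.rpow_natCast, ← Real.rpow_mul (by positivity),
      ← Real.rpow_mul (by positivity), mul_comm]
  have hpos : (0 : ℝ) ≤ (1 + (l : ℝ)) ^ p := Real.rpow_nonneg (by positivity) p
  obtain ⟨ha, hb⟩ := h l
  have ha2 := pow_le_pow_left₀ (by positivity) ha 2
  have hb2 := pow_le_pow_left₀ (abs_nonneg _) hb 2
  rw [sq_abs, mul_pow, hsq] at ha2 hb2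
  constructor
  · rw [inv_mul_eq_div, le_div_iff₀' (by positivity)]
    refine le_trans ?_ ha2
    gcongr
    nlinarith
  · refine hb2.trans ?_
    rw [mul_assoc, ← Real.mul_rpow (by norm_num) (by positivity)]
    gcongr
    nlinarith

lemma mem_sobolevS_iff (D : AdmissibleOperator p) (f : L2S) :
    f ∈ sobolevS p ↔ Summable fun q : HarmIdx => (inner ℝ f (Y q) * D.coeff q.deg) ^ 2 := by
  obtain ⟨c₁, c₂, h₁, h₂, h⟩ := D.exists_sq_bounds
  constructor
  · intro hf
    refine Summable.of_nonneg_of_le (fun q => sq_nonneg _) (fun q => ?_)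
      (Summable.mul_left c₂ hf)
    rw [mul_pow, mul_comm, ← mul_assoc]
    exact mul_le_mul_of_nonneg_right (h q.deg).2 (sq_nonneg _)
  · intro hf
    refine Summable.of_nonneg_of_le (fun q => ?_) (fun q => ?_) (Summable.mul_left c₁ hf)
    · exact mul_nonneg (sobolev_weight_pos _).le (sq_nonneg _)
    · rw [mul_pow, mul_comm (inner ℝ f (Y q) ^ 2), ← mul_assoc]
      exact mul_le_mul_of_nonneg_right (h q.deg).1 (sq_nonneg _)

lemma mem_sobolevSS_iff (D : AdmissibleOperator p) (g : L2SS) :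
    g ∈ sobolevSS p ↔ Summable fun k : HarmIdx × HarmIdx =>
      (inner ℝ g (YY k) * (D.coeff k.1.deg * D.coeff k.2.deg)) ^ 2 := by
  obtain ⟨c₁, c₂, h₁, h₂, h⟩ := D.exists_sq_bounds
  constructor
  · intro hg
    refine Summable.of_nonneg_of_le (fun k => sq_nonneg _) (fun k => ?_)
      (Summable.mul_left (c₂ * c₂) hg)
    rw [mul_pow, mul_pow, mul_comm, ← mul_assoc]
    refine mul_le_mul_of_nonneg_right ?_ (sq_nonneg _)
    refine (mul_le_mul (h k.1.deg).2 (h k.2.deg).2 (sq_nonneg _)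
      (mul_nonneg h₂.le (sobolev_weight_pos _).le)).trans_eq ?_
    ring
  · intro hg
    refine Summable.of_nonneg_of_le (fun k => ?_) (fun k => ?_) (Summable.mul_left (c₁ * c₁) hg)
    · exact mul_nonneg (mul_nonneg (sobolev_weight_pos _).le (sobolev_weight_pos _).le)
        (sq_nonneg _)
    · rw [mul_pow, mul_pow, mul_comm (inner ℝ g (YY k) ^ 2), ← mul_assoc]
      refine mul_le_mul_of_nonneg_right ?_ (sq_nonneg _)
      refine (mul_le_mul (h k.1.deg).1 (h k.2.deg).1 (sobolev_weight_pos _).le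
        (mul_nonneg h₁.le (sq_nonneg _))).trans_eq ?_
      ring

/-! ### The zonal Green's kernel -/

/-- For `p > 1` the zonal kernels, which are of size `2l + 1`, have a convergent sum with the
weights `1 / D_l²`. -/
lemma AdmissibleOperator.summable_zonal_bound (hp : 1 < p) (D : AdmissibleOperator p) :
    Summable fun l : ℕ => 1 / D.coeff l ^ 2 * ((2 * l + 1) / (4 * Real.pi)) := by
  obtain ⟨C₁, C₂, h₁, h₂, h⟩ := D.growth
  have hs := (Real.summable_one_div_nat_add_rpow 1 (2 * p - 1)).mpr (by linarith)
  refine Summable.of_nonneg_of_le (fun l => by positivity) (fun l => ?_) (hs.mul_left (1 / C₁ ^ 2))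
  have hl : (0 : ℝ) ≤ l := Nat.cast_nonneg l
  have hl1 : (0 : ℝ) < 1 + l := by positivity
  have hpow : ((1 + (l : ℝ)) ^ p) ^ 2 = (1 + (l : ℝ)) ^ (2 * p - 1) * (1 + l) := by
    rw [← Real.rpow_natCast, ← Real.rpow_mul hl1.le]
    nth_rewrite 3 [← Real.rpow_one (1 + (l : ℝ))]
    rw [← Real.rpow_add hl1]
    congr 1
    push_cast
    ring
  have ha2 := pow_le_pow_left₀ (by positivity) (h l).1 2
  rw [sq_abs, mul_pow, hpow] at ha2
  rw [abs_of_pos (by positivity), add_comm (l : ℝ) 1]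
  have hr : 0 < (1 + (l : ℝ)) ^ (2 * p - 1) := Real.rpow_pos_of_pos hl1 _
  have hpi := Real.pi_gt_three
  rw [div_mul_div_comm, div_mul_div_comm, one_mul, one_mul,
    div_le_div_iff₀ (mul_pos (sq_pos_of_ne_zero (D.coeff_ne_zero l)) (by positivity))
      (by positivity), one_mul]
  have h3 : (2 * (l : ℝ) + 1) ≤ (1 + l) * (4 * Real.pi) := by nlinarith
  calc (2 * (l : ℝ) + 1) * (C₁ ^ 2 * (1 + l) ^ (2 * p - 1))
      ≤ (1 + l) * (4 * Real.pi) * (C₁ ^ 2 * (1 + l) ^ (2 * p - 1)) := by gcongr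
    _ = C₁ ^ 2 * ((1 + l) ^ (2 * p - 1) * (1 + l)) * (4 * Real.pi) := by ring
    _ ≤ D.coeff l ^ 2 * (4 * Real.pi) := by gcongr

/-- The zonal Green's kernel `ψ(t) = ∑_l D_l⁻² p_l(t)` of `D* D`. -/
def greenKer (D : AdmissibleOperator p) : C(Set.Icc (-1 : ℝ) 1, ℝ) :=
  ∑' l, (1 / D.coeff l ^ 2) • (zonalPoly l).toContinuousMapOn (Set.Icc (-1 : ℝ) 1)

/-- The series of `greenKer` converges uniformly, and can be evaluated termwise. -/
lemma hasSum_greenKer_zonal (hp : 1 < p) (D : AdmissibleOperator p) (u v : S2) :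
    HasSum (fun l => 1 / D.coeff l ^ 2 * zonal l u v) (greenKer D (dot u v)) := by
  have hs : Summable fun l : ℕ =>
      (1 / D.coeff l ^ 2) • (zonalPoly l).toContinuousMapOn (Set.Icc (-1 : ℝ) 1) := by
    refine Summable.of_norm_bounded (D.summable_zonal_bound hp) fun l => ?_
    rw [norm_smul, Real.norm_of_nonneg (by positivity)]
    refine mul_le_mul_of_nonneg_left ?_ (by positivity)
    refine (ContinuousMap.norm_le _ (by positivity)).mpr fun t => ?_
    obtain ⟨w, rfl⟩ := exists_dot_eq t
    have h := abs_zonal_le l w pole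
    rwa [zonal_eq] at h
  have h := hs.hasSum.mapL (ContinuousMap.evalCLM ℝ (dot u v))
  refine h.congr_fun fun l => ?_
  rw [zonal_eq]
  rfl

/-- The indices `(l, m)`, grouped by degree. -/
def harmIdxEquiv : (Σ l : ℕ, Finset.Icc (-(l : ℤ)) l) ≃ HarmIdx where
  toFun s := ⟨(s.1, s.2.1), Finset.mem_Icc.mp s.2.2⟩
  invFun q := ⟨q.1.1, q.1.2, Finset.mem_Icc.mpr q.2⟩
  left_inv _ := rfl
  right_inv _ := rfl

lemma zonal_eq_sum_coe (l : ℕ) (u v : S2) : zonal l u v =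
    ∑ m : Finset.Icc (-(l : ℤ)) l, sphHarm l m u * sphHarm l m v :=
  (Finset.sum_coe_sort _ fun m : ℤ => sphHarm l m u * sphHarm l m v).symm

lemma summable_harm_sq (hp : 1 < p) (D : AdmissibleOperator p) (u : S2) :
    Summable fun q : HarmIdx => 1 / D.coeff q.deg ^ 2 * (harm q u * harm q u) := by
  rw [← harmIdxEquiv.summable_iff, summable_sigma_of_nonneg]
  · refine ⟨fun l => Summable.of_finite, ?_⟩
    refine (hasSum_greenKer_zonal hp D u u).summable.congr fun l => ?_
    rw [tsum_fintype, zonal_eq_sum_coe, Finset.mul_sum]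
    rfl
  · intro s
    exact mul_nonneg (by positivity) (mul_self_nonneg _)

lemma summable_harm_mul (hp : 1 < p) (D : AdmissibleOperator p) (u v : S2) :
    Summable fun q : HarmIdx => ‖1 / D.coeff q.deg ^ 2 * (harm q u * harm q v)‖ := by
  refine Summable.of_nonneg_of_le (fun q => norm_nonneg _) (fun q => ?_)
    ((summable_harm_sq hp D u).add (summable_harm_sq hp D v))
  rw [norm_mul, Real.norm_of_nonneg (by positivity : 0 ≤ 1 / D.coeff q.deg ^ 2), ← mul_add,
    Real.norm_eq_abs]
  refine mul_le_mul_of_nonneg_left (abs_le.mpr ⟨?_, ?_⟩) (by positivity)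
  · nlinarith [sq_nonneg (harm q u + harm q v), mul_self_nonneg (harm q u),
      mul_self_nonneg (harm q v)]
  · nlinarith [sq_nonneg (harm q u - harm q v), mul_self_nonneg (harm q u),
      mul_self_nonneg (harm q v)]

/-- The expansion of the Green's kernel in products of spherical harmonics. -/
lemma hasSum_greenKer (hp : 1 < p) (D : AdmissibleOperator p) (u v : S2) :
    HasSum (fun q : HarmIdx => 1 / D.coeff q.deg ^ 2 * (harm q u * harm q v))
      (greenKer D (dot u v)) := by
  have hs := harmIdxEquiv.summable_iff.mpr (summable_harm_mul hp D u v).of_norm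
  rw [← harmIdxEquiv.hasSum_iff, ← (hasSum_greenKer_zonal hp D u v).tsum_eq]
  have h : ∑' l, 1 / D.coeff l ^ 2 * zonal l u v =
      ∑' s, ((fun q : HarmIdx => 1 / D.coeff q.deg ^ 2 * (harm q u * harm q v)) ∘ harmIdxEquiv) s := by
    rw [hs.tsum_sigma' fun l => Summable.of_finite]
    refine tsum_congr fun l => ?_
    rw [tsum_fintype, zonal_eq_sum_coe, Finset.mul_sum]
    rfl
  rw [h]
  exact hs.hasSum

lemma sum_harm_div_sq_le (hp : 1 < p) (D : AdmissibleOperator p) (u : S2) (s : Finset HarmIdx) :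
    ∑ q ∈ s, (harm q u / D.coeff q.deg) ^ 2 ≤ greenKer D (dot pole pole) := by
  have h := sum_le_hasSum s (fun q _ => mul_nonneg (by positivity) (mul_self_nonneg _))
    (hasSum_greenKer hp D u u)
  rw [show dot u u = dot pole pole from Subtype.ext ((dot_self u).trans (dot_self pole).symm)] at h
  refine le_trans (Finset.sum_le_sum fun q _ => ?_) h
  rw [div_pow, div_mul_eq_mul_div, one_mul, sq (harm q u)]

/-- The function `v ↦ ψ ⟨u, v⟩`. -/
def zonalAt (ψ : C(Set.Icc (-1 : ℝ) 1, ℝ)) (u : S2) : C(S2, ℝ) :=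
  ⟨fun v => ψ (dot u v), ψ.continuous.comp (Continuous.subtype_mk (by fun_prop) _)⟩

@[simp] lemma zonalAt_apply (ψ : C(Set.Icc (-1 : ℝ) 1, ℝ)) (u v : S2) :
    zonalAt ψ u v = ψ (dot u v) := rfl

/-- The spherical Fourier coefficients of `ψ ⟨u, ·⟩`. -/
lemma inner_zonalAt_greenKer (hp : 1 < p) (D : AdmissibleOperator p) (u : S2) (q : HarmIdx) :
    inner ℝ (clsS (zonalAt (greenKer D) u)) (Y q) = 1 / D.coeff q.deg ^ 2 * harm q u := by
  have hs : Summable fun q : HarmIdx => (1 / D.coeff q.deg ^ 2 * harm q u) • harm q := by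
    refine summable_smul_of_weighted (fun q : HarmIdx => D.coeff_ne_zero q.deg) ?_
      (sum_harm_div_sq_le hp D)
    refine (summable_harm_sq hp D u).congr fun q => ?_
    have := D.coeff_ne_zero q.deg
    field_simp
  have h1 : ∑' q : HarmIdx, (1 / D.coeff q.deg ^ 2 * harm q u) • harm q
      = zonalAt (greenKer D) u := by
    ext v
    have h2 := hs.hasSum.mapL (ContinuousMap.evalCLM ℝ v)
    refine h2.unique ((hasSum_greenKer hp D u v).congr_fun fun q => ?_)
    simp [mul_assoc]
  have h3 := (h1 ▸ hs.hasSum).mapL (ContinuousMap.toLp 2 surf ℝ)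
  have h4 := h3.mapL (innerSL ℝ (Y q))
  rw [real_inner_comm]
  classical
  refine h4.unique ((hasSum_ite_eq q (1 / D.coeff q.deg ^ 2 * harm q u)).congr_fun fun q' => ?_)
  rw [map_smul, map_smul, innerSL_apply_apply]
  change _ • inner ℝ (Y q) (Y q') = _
  rw [orthonormal_iff_ite.mp orthonormal_Y]
  by_cases h : q' = q
  · subst h
    simp
  · simp [h, Ne.symm h]

lemma coeff_adjoint_comp (D : AdmissibleOperator p) (l : ℕ) :
    (D.adjoint.comp D).coeff l = D.coeff l ^ 2 := by
  simp [AdmissibleOperator.comp, AdmissibleOperator.adjoint, sq]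

lemma inner_op (E : AdmissibleOperator p) {f : L2S} (hf : f ∈ sobolevS p) (q : HarmIdx) :
    inner ℝ (E.op f) (Y q) = E.coeff q.deg * inner ℝ f (Y q) := by
  rw [mem_sobolevS_iff E] at hf
  obtain ⟨h, h1, h2⟩ := exists_hasSum_smul_basis harmBasis
    (fun q => E.coeff q.deg * inner ℝ f (Y q)) (hf.congr fun q => by rw [mul_comm])
  simp only [harmBasis_apply] at h1 h2
  rw [AdmissibleOperator.op, h1.tsum_eq, h2]

lemma integral_zonal_mul (ψ : C(Set.Icc (-1 : ℝ) 1, ℝ)) (u : S2) (F : L2S) :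
    ∫ v, ψ (dot u v) * F v ∂surf = inner ℝ (clsS (zonalAt ψ u)) F := by
  rw [L2.inner_def]
  refine integral_congr_ae ?_
  filter_upwards [ContinuousMap.coeFn_toLp (p := 2) (𝕜 := ℝ) surf (zonalAt ψ u)] with v hv
  change _ = inner ℝ (ContinuousMap.toLp 2 surf ℝ (zonalAt ψ u) v) _
  rw [hv]
  simp [mul_comm]

/-- Smooth functions are the pointwise sums of their spherical Fourier series. -/
lemma hasSum_of_mem_sobolevS (hp : 1 < p) (D : AdmissibleOperator p) {φ : C(S2, ℝ)}
    (hφ : clsS φ ∈ sobolevS p) (u : S2) :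
    HasSum (fun q => inner ℝ (clsS φ) (Y q) * harm q u) (φ u) := by
  obtain ⟨c, h1, h2⟩ := exists_continuous_rep harmBasis (e := harm) (fun q => harmBasis_apply q)
    (fun q : HarmIdx => D.coeff_ne_zero q.deg) (sum_harm_div_sq_le hp D) (g := clsS φ)
    (by simpa only [harmBasis_apply] using (mem_sobolevS_iff D _).mp hφ)
  obtain rfl : c = φ := ContinuousMap.toLp_injective surf h1
  simpa only [harmBasis_apply] using h2 u

lemma isZonalGreenKernel_greenKer (hp : 1 < p) (D : AdmissibleOperator p) :
    IsZonalGreenKernel (D.adjoint.comp D) (greenKer D) := by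
  intro u φ hφ
  have hp0 : 0 ≤ p := by linarith
  rw [integral_zonal_mul]
  have h1 := harmBasis.hasSum_inner_mul_inner (clsS (zonalAt (greenKer D) u))
    ((D.adjoint.comp D).op (clsS φ))
  refine h1.unique ((hasSum_of_mem_sobolevS hp D (hφ p hp0) u).congr_fun fun q => ?_)
  rw [harmBasis_apply, inner_zonalAt_greenKer hp, real_inner_comm,
    inner_op _ (hφ (p + p) (by linarith)), coeff_adjoint_comp]
  have := D.coeff_ne_zero q.deg
  field_simp

lemma harm_mem_smoothS (q : HarmIdx) : harm q ∈ smoothS := by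
  intro s _
  refine summable_of_ne_finset_zero (s := {q}) fun q' hq' => ?_
  change _ * inner ℝ (Y q) (Y q') ^ 2 = 0
  have h : q ≠ q' := fun h => hq' (by simp [h])
  rw [orthonormal_Y.2 h]
  simp

lemma op_Y (E : AdmissibleOperator p) (q : HarmIdx) : E.op (Y q) = E.coeff q.deg • Y q := by
  rw [AdmissibleOperator.op, tsum_eq_single q]
  · rw [real_inner_self_eq_norm_sq, orthonormal_Y.1 q]
    simp
  · intro q' h
    rw [orthonormal_Y.2 (Ne.symm h)]
    simp

/-- Testing against the spherical harmonics shows that the spherical Fourier coefficients of a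
zonal Green's kernel are determined. -/
lemma eq_of_isZonalGreenKernel {E : AdmissibleOperator p} {ψ ψ' : C(Set.Icc (-1 : ℝ) 1, ℝ)}
    (h : IsZonalGreenKernel E ψ) (h' : IsZonalGreenKernel E ψ') : ψ = ψ' := by
  have key : ∀ {ψ : C(Set.Icc (-1 : ℝ) 1, ℝ)}, IsZonalGreenKernel E ψ → ∀ u q,
      E.coeff q.deg * inner ℝ (clsS (zonalAt ψ u)) (Y q) = harm q u := fun {ψ} h u q => by
    have h1 := h u (harm q) (harm_mem_smoothS q)
    rw [integral_zonal_mul] at h1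
    change inner ℝ _ (E.op (Y q)) = _ at h1
    rwa [op_Y, real_inner_smul_right] at h1
  ext t
  obtain ⟨u, rfl⟩ := exists_dot_eq t
  have h1 : zonalAt ψ u = zonalAt ψ' u := by
    refine ContinuousMap.toLp_injective (p := 2) (𝕜 := ℝ) surf
      (ext_inner_basis harmBasis fun q => ?_)
    rw [harmBasis_apply]
    exact mul_left_cancel₀ (E.coeff_ne_zero q.deg) ((key h u q).trans (key h' u q).symm)
  exact DFunLike.congr_fun h1 pole

end Sobolev

/-! ### The tensorial Sobolev space as a reproducing kernel Hilbert space -/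

section Tensor

variable {p : ℝ}

/-- The eigenvalue `D_l D_{l'}` of `D ⊗ D`. -/
def AdmissibleOperator.tensorCoeff (D : AdmissibleOperator p) (k : HarmIdx × HarmIdx) : ℝ :=
  D.coeff k.1.deg * D.coeff k.2.deg

lemma AdmissibleOperator.tensorCoeff_ne_zero (D : AdmissibleOperator p) (k : HarmIdx × HarmIdx) :
    D.tensorCoeff k ≠ 0 :=
  mul_ne_zero (D.coeff_ne_zero _) (D.coeff_ne_zero _)

/-- The kernel `(x, y) ↦ ψ ⟨x₁, y₁⟩ ψ ⟨x₂, y₂⟩` of the product of two spheres. -/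
def greenKer₂ (D : AdmissibleOperator p) (x y : S2 × S2) : ℝ :=
  greenKer D (dot x.1 y.1) * greenKer D (dot x.2 y.2)

lemma hasSum_greenKer₂ (hp : 1 < p) (D : AdmissibleOperator p) (x y : S2 × S2) :
    HasSum (fun k => harm₂ k x / D.tensorCoeff k * (harm₂ k y / D.tensorCoeff k))
      (greenKer₂ D x y) := by
  have h := (hasSum_greenKer hp D x.1 y.1).mul (hasSum_greenKer hp D x.2 y.2)
    (summable_mul_of_summable_norm (summable_harm_mul hp D x.1 y.1)
      (summable_harm_mul hp D x.2 y.2))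
  refine h.congr_fun fun k => ?_
  have h1 := D.coeff_ne_zero k.1.deg
  have h2 := D.coeff_ne_zero k.2.deg
  simp only [AdmissibleOperator.tensorCoeff, harm₂, tensor_apply]
  field_simp

lemma sum_harm₂_div_sq_le (hp : 1 < p) (D : AdmissibleOperator p) (x : S2 × S2)
    (s : Finset (HarmIdx × HarmIdx)) :
    ∑ k ∈ s, (harm₂ k x / D.tensorCoeff k) ^ 2 ≤ greenKer D (dot pole pole) ^ 2 := by
  have h := sum_le_hasSum s (fun k _ => mul_self_nonneg _) (hasSum_greenKer₂ hp D x x)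
  have hd : ∀ u : S2, dot u u = dot pole pole := fun u =>
    Subtype.ext ((dot_self u).trans (dot_self pole).symm)
  rw [greenKer₂, hd x.1, hd x.2] at h
  simpa only [sq] using h

lemma exists_clsSS_eq (hp : 1 < p) (D : AdmissibleOperator p) {g : L2SS} (hg : g ∈ sobolevSS p) :
    ∃ c, clsSS c = g ∧ ∀ x, HasSum (fun k => inner ℝ g (YY k) * harm₂ k x) (c x) := by
  obtain ⟨c, h1, h2⟩ := exists_continuous_rep harmBasis₂ (e := harm₂)
    (fun k => harmBasis₂_apply k) D.tensorCoeff_ne_zero (sum_harm₂_div_sq_le hp D) (g := g)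
    (by simp only [harmBasis₂_apply]; exact (mem_sobolevSS_iff D g).mp hg)
  exact ⟨c, h1, by simpa only [harmBasis₂_apply] using h2⟩

lemma clsSS_injective : Function.Injective clsSS :=
  ContinuousMap.toLp_injective (surf.prod surf)

lemma contRep_eq {g : L2SS} {c : C(S2 × S2, ℝ)} (h : clsSS c = g) : contRep g = c := by
  have he : ∃ c : C(S2 × S2, ℝ), clsSS c = g := ⟨c, h⟩
  rw [contRep, dif_pos he]
  exact clsSS_injective (he.choose_spec.trans h.symm)

lemma hasSum_contRep (hp : 1 < p) (D : AdmissibleOperator p) {g : L2SS} (hg : g ∈ sobolevSS p)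
    (x : S2 × S2) : HasSum (fun k => inner ℝ g (YY k) * harm₂ k x) (contRep g x) := by
  obtain ⟨c, h1, h2⟩ := exists_clsSS_eq hp D hg
  rw [contRep_eq h1]
  exact h2 x

lemma hasSum_tensorTerm (D : AdmissibleOperator p) {g : L2SS} (hg : g ∈ sobolevSS p) :
    HasSum (D.tensorTerm g) (D.tensorOp g) ∧
      ∀ k, inner ℝ (D.tensorOp g) (YY k) = D.tensorCoeff k * inner ℝ g (YY k) := by
  obtain ⟨h, h1, h2⟩ := exists_hasSum_smul_basis harmBasis₂
    (fun k => D.tensorCoeff k * inner ℝ g (YY k))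
    (((mem_sobolevSS_iff D g).mp hg).congr fun k => by rw [mul_comm]; rfl)
  simp only [harmBasis₂_apply] at h1 h2
  have h3 : HasSum (D.tensorTerm g) h := h1
  rw [AdmissibleOperator.tensorOp, h3.tsum_eq]
  exact ⟨h3, h2⟩

/-- The inverse of `D ⊗ D`, which maps `L²` onto the tensorial Sobolev space. -/
def tensorInv (D : AdmissibleOperator p) (h : L2SS) : L2SS :=
  ∑' k, (inner ℝ h (YY k) / D.tensorCoeff k) • YY k

lemma inner_tensorInv (D : AdmissibleOperator p) (h : L2SS) (k : HarmIdx × HarmIdx) :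
    inner ℝ (tensorInv D h) (YY k) = inner ℝ h (YY k) / D.tensorCoeff k := by
  obtain ⟨c, c', hc, hc', hD⟩ := D.exists_sq_bounds
  -- the eigenvalues of `D` are bounded away from zero
  have hone : ∀ l : ℕ, 1 ≤ c * D.coeff l ^ 2 := fun l =>
    (Real.one_le_rpow (by nlinarith [(Nat.cast_nonneg l : (0 : ℝ) ≤ l)]) D.order_nonneg).trans
      (hD l).1
  have hs : Summable fun k => (inner ℝ h (YY k) / D.tensorCoeff k) ^ 2 := by
    have h1 := (hasSum_inner_basis_sq harmBasis₂ h).summable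
    simp only [harmBasis₂_apply] at h1
    refine Summable.of_nonneg_of_le (fun k => sq_nonneg _) (fun k => ?_) (h1.mul_left (c * c))
    have h2 : 1 ≤ c * c * D.tensorCoeff k ^ 2 := by
      have := one_le_mul_of_one_le_of_one_le (hone k.1.deg) (hone k.2.deg)
      rw [AdmissibleOperator.tensorCoeff]
      linarith
    have h3 : 0 < D.tensorCoeff k ^ 2 := sq_pos_of_ne_zero (D.tensorCoeff_ne_zero k)
    rw [div_pow, div_le_iff₀ h3]
    nlinarith [sq_nonneg (inner ℝ h (YY k) : ℝ)]
  obtain ⟨g, h1, h2⟩ := exists_hasSum_smul_basis harmBasis₂ _ hs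
  simp only [harmBasis₂_apply] at h1 h2
  rw [tensorInv, h1.tsum_eq, h2]

lemma tensorInv_mem (D : AdmissibleOperator p) (h : L2SS) : tensorInv D h ∈ sobolevSS p := by
  rw [mem_sobolevSS_iff D]
  have h1 := (hasSum_inner_basis_sq harmBasis₂ h).summable
  refine h1.congr fun k => ?_
  rw [inner_tensorInv, harmBasis₂_apply]
  exact congrArg (· ^ 2) (div_mul_cancel₀ _ (D.tensorCoeff_ne_zero k)).symm

lemma tensorOp_tensorInv (D : AdmissibleOperator p) (h : L2SS) :
    D.tensorOp (tensorInv D h) = h := by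
  refine ext_inner_basis harmBasis₂ fun k => ?_
  rw [harmBasis₂_apply, (hasSum_tensorTerm D (tensorInv_mem D h)).2, inner_tensorInv]
  exact mul_div_cancel₀ _ (D.tensorCoeff_ne_zero k)

lemma tensorInv_tensorOp (D : AdmissibleOperator p) {g : L2SS} (hg : g ∈ sobolevSS p) :
    tensorInv D (D.tensorOp g) = g := by
  refine ext_inner_basis harmBasis₂ fun k => ?_
  rw [harmBasis₂_apply, inner_tensorInv, (hasSum_tensorTerm D hg).2]
  exact mul_div_cancel_left₀ _ (D.tensorCoeff_ne_zero k)

/-- The vector `Φ_x` of `L²` that represents the evaluation at `x`, transported by `D ⊗ D`: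
`⟨(D ⊗ D) g, Φ_x⟩ = g x`. -/
def feature (D : AdmissibleOperator p) (x : S2 × S2) : L2SS :=
  ∑' k, (harm₂ k x / D.tensorCoeff k) • YY k

lemma inner_feature_YY (hp : 1 < p) (D : AdmissibleOperator p) (x : S2 × S2)
    (k : HarmIdx × HarmIdx) :
    inner ℝ (feature D x) (YY k) = harm₂ k x / D.tensorCoeff k := by
  obtain ⟨g, h1, h2⟩ := exists_hasSum_smul_basis harmBasis₂
    (fun k => harm₂ k x / D.tensorCoeff k)
    ((hasSum_greenKer₂ hp D x x).summable.congr fun k => by rw [sq])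
  simp only [harmBasis₂_apply] at h1 h2
  rw [feature, h1.tsum_eq, h2]

lemma inner_feature (hp : 1 < p) (D : AdmissibleOperator p) (x y : S2 × S2) :
    inner ℝ (feature D x) (feature D y) = greenKer₂ D x y := by
  refine (harmBasis₂.hasSum_inner_mul_inner (feature D x) (feature D y)).unique
    ((hasSum_greenKer₂ hp D x y).congr_fun fun k => ?_)
  rw [real_inner_comm (feature D y), harmBasis₂_apply, inner_feature_YY hp, inner_feature_YY hp]

lemma contRep_tensorInv (hp : 1 < p) (D : AdmissibleOperator p) (h : L2SS) (x : S2 × S2) :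
    contRep (tensorInv D h) x = inner ℝ h (feature D x) := by
  refine (hasSum_contRep hp D (tensorInv_mem D h) x).unique
    ((harmBasis₂.hasSum_inner_mul_inner h (feature D x)).congr_fun fun k => ?_)
  rw [real_inner_comm (feature D x), harmBasis₂_apply, inner_feature_YY hp, inner_tensorInv]
  ring

/-- Distinct points of the product of two spheres impose independent conditions on the products of
spherical harmonics, because these span a dense subspace of the continuous functions. -/
lemma eq_zero_of_sum_harm₂ {ι : Type*} [Fintype ι] {x : ι → S2 × S2} (hx : Function.Injective x)
    {c : ι → ℝ} (h : ∀ k, ∑ a, c a * harm₂ k (x a) = 0) : c = 0 := by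
  classical
  let Λ : C(S2 × S2, ℝ) →L[ℝ] ℝ := ∑ a, c a • ContinuousMap.evalCLM ℝ (x a)
  have hΛ : ∀ f, Λ f = ∑ a, c a * f (x a) := fun f => by
    simp [Λ]
  have h0 : ∀ f, Λ f = 0 := by
    have hcl : IsClosed {f | Λ f = 0} := isClosed_eq Λ.continuous continuous_const
    have hsub : (Submodule.span ℝ (Set.range harm₂) : Set C(S2 × S2, ℝ)) ⊆ {f | Λ f = 0} := by
      have : Submodule.span ℝ (Set.range harm₂) ≤ LinearMap.ker Λ.toLinearMap := by
        refine Submodule.span_le.mpr ?_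
        rintro _ ⟨k, rfl⟩
        exact (hΛ _).trans (h k)
      exact this
    exact fun f => hcl.closure_subset_iff.mpr hsub (dense_span_harm₂ f)
  funext a
  -- a continuous function that vanishes exactly at the other points
  let f : C(S2 × S2, ℝ) := ∏ b ∈ Finset.univ.erase a, ⟨fun y => dist y (x b), by fun_prop⟩
  have hf : ∀ y, f y = ∏ b ∈ Finset.univ.erase a, dist y (x b) := fun y => by
    simp [f, ContinuousMap.prod_apply]
  have h1 := h0 f
  rw [hΛ, Finset.sum_eq_single a] at h1
  · refine (mul_eq_zero.mp h1).resolve_right ?_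
    rw [hf]
    exact Finset.prod_ne_zero_iff.mpr fun b hb => dist_ne_zero.mpr fun hab =>
      Finset.ne_of_mem_erase hb (hx hab).symm
  · intro b _ hb
    have h2 : ∏ b' ∈ Finset.univ.erase a, dist (x b) (x b') = 0 :=
      Finset.prod_eq_zero (Finset.mem_erase.mpr ⟨hb, Finset.mem_univ b⟩) (dist_self (x b))
    rw [hf, h2, mul_zero]
  · simp

end Tensor

/-! ### Ridge regression in a Hilbert space -/

section Ridge

variable {E ι : Type*} [NormedAddCommGroup E] [InnerProductSpace ℝ E] [Fintype ι] [DecidableEq ι]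

lemma isUnit_gram_add_smul (φ : ι → E) {lam : ℝ} (hlam : 0 < lam) :
    IsUnit (Matrix.gram ℝ φ + lam • (1 : Matrix ι ι ℝ)) := by
  rw [add_comm]
  exact ((Matrix.PosDef.one.smul hlam).add_posSemidef (Matrix.posSemidef_gram ℝ φ)).isUnit

/-- The solution of the normal equations satisfies a Pythagorean identity. -/
lemma ridge_identity (φ : ι → E) (z β : ι → ℝ) {c η lam : ℝ} (hlam : c * lam = η)
    (hβ : (Matrix.gram ℝ φ + lam • (1 : Matrix ι ι ℝ)).mulVec β = z) (h : E) :
    c * ∑ a, (z a - inner ℝ h (φ a)) ^ 2 + η * ‖h‖ ^ 2 =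
      (c * ∑ a, (z a - inner ℝ (∑ b, β b • φ b) (φ a)) ^ 2 + η * ‖∑ b, β b • φ b‖ ^ 2) +
      (c * ∑ a, (inner ℝ (h - ∑ b, β b • φ b) (φ a)) ^ 2 + η * ‖h - ∑ b, β b • φ b‖ ^ 2) := by
  set s := ∑ b, β b • φ b with hs
  have h1 : ∀ a, z a - inner ℝ s (φ a) = lam * β a := fun a => by
    rw [← hβ, hs, sum_inner, Matrix.add_mulVec, Matrix.smul_mulVec, Matrix.one_mulVec]
    simp only [Pi.add_apply, Pi.smul_apply, smul_eq_mul, Matrix.mulVec, dotProduct, Matrix.gram_apply,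
      real_inner_smul_left]
    have : ∑ b, inner ℝ (φ a) (φ b) * β b = ∑ b, β b * inner ℝ (φ b) (φ a) :=
      Finset.sum_congr rfl fun b _ => by rw [real_inner_comm, mul_comm]
    rw [this]
    ring
  have h2 : inner ℝ s (h - s) = ∑ a, β a * inner ℝ (h - s) (φ a) := by
    rw [hs, sum_inner]
    exact Finset.sum_congr rfl fun a _ => by rw [real_inner_smul_left, real_inner_comm]
  have h3 : ‖h‖ ^ 2 = ‖s‖ ^ 2 + 2 * inner ℝ s (h - s) + ‖h - s‖ ^ 2 := by
    rw [← norm_add_sq_real, add_sub_cancel]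
  have h4 : ∑ a, (z a - inner ℝ h (φ a)) ^ 2 = ∑ a, (z a - inner ℝ s (φ a)) ^ 2
      - 2 * lam * ∑ a, β a * inner ℝ (h - s) (φ a) + ∑ a, (inner ℝ (h - s) (φ a)) ^ 2 := by
    rw [Finset.mul_sum, ← Finset.sum_sub_distrib, ← Finset.sum_add_distrib]
    refine Finset.sum_congr rfl fun a _ => ?_
    have h5 : (inner ℝ h (φ a) : ℝ) = inner ℝ s (φ a) + inner ℝ (h - s) (φ a) := by
      rw [← inner_add_left, add_sub_cancel]
    rw [h5]
    linear_combination (-2 * inner ℝ (h - s) (φ a)) * h1 a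
  rw [h3, h4, h2, ← hlam]
  ring

end Ridge

/-! ### The regularized least-squares problem -/

section Problem

variable {p : ℝ} (D : AdmissibleOperator p) {n : ℕ} (r : Fin n → ℕ)
  (w : (i : Fin n) → Fin (r i) → ℝ) (u : (i : Fin n) → Fin (r i) → S2)

/-- The point `(u_ij, u_ik)` of the triple `(i, j, k)`. -/
def dataPoint (a : OffDiag r) : S2 × S2 := (u a.1 a.2.1.1, u a.1 a.2.1.2)

/-- The normalized representer of the evaluation at the point of the triple `(i, j, k)`. -/
def dataFeature (a : OffDiag r) : L2SS := (1 / scale r a) • feature D (dataPoint r u a)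

variable {r u}

lemma dataPoint_injective
    (hu : Function.Injective fun a : (i : Fin n) × Fin (r i) => u a.1 a.2) :
    Function.Injective (dataPoint r u) := by
  rintro ⟨i, ⟨j, k⟩, h⟩ ⟨i', ⟨j', k'⟩, h'⟩ hab
  have h1 : (⟨i, j⟩ : (i : Fin n) × Fin (r i)) = ⟨i', j'⟩ := hu (congrArg Prod.fst hab)
  have h2 : (⟨i, k⟩ : (i : Fin n) × Fin (r i)) = ⟨i', k'⟩ := hu (congrArg Prod.snd hab)
  cases h1
  cases h2
  rfl

lemma scale_pos (a : OffDiag r) : 0 < scale r a := by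
  obtain ⟨i, ⟨j, k⟩, h⟩ := a
  have h1 : 2 ≤ r i := by
    have hj := j.isLt
    have hk := k.isLt
    have hne : (j : ℕ) ≠ k := fun h' => h (Fin.ext h')
    omega
  have h2 : (2 : ℝ) ≤ r i := by exact_mod_cast h1
  exact Real.sqrt_pos.mpr (mul_pos (by linarith) (by linarith))

lemma scale_sq (a : OffDiag r) : scale r a ^ 2 = (r a.1 : ℝ) * ((r a.1 : ℝ) - 1) :=
  Real.sq_sqrt (Real.sqrt_pos.mp (scale_pos a)).le

lemma gram_eq (hp : 1 < p) : gram r u (greenKer D) = Matrix.gram ℝ (dataFeature D r u) := by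
  ext a b
  rw [Matrix.gram_apply, dataFeature, dataFeature, real_inner_smul_left, real_inner_smul_right,
    inner_feature hp, gram, mul_assoc _ (r b.1 : ℝ),
    Real.sqrt_mul (Real.sqrt_pos.mp (scale_pos a)).le]
  change _ / (scale r a * scale r b) = _
  rw [greenKer₂, dataPoint, dataPoint]
  field_simp

lemma splineForm_eq (hp : 1 < p) (β : OffDiag r → ℝ) (x y : S2) :
    splineForm r u (greenKer D) β x y =
      inner ℝ (∑ a, β a • dataFeature D r u a) (feature D (x, y)) := by
  rw [sum_inner, Fintype.sum_sigma, splineForm]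
  refine Finset.sum_congr rfl fun i _ => ?_
  rw [Finset.mul_sum]
  refine Finset.sum_congr rfl fun jk _ => ?_
  rw [real_inner_smul_left, dataFeature, real_inner_smul_left, real_inner_comm, inner_feature hp]
  simp only [greenKer₂, dataPoint, scale]
  ring

/-- The cost in terms of `h = (D ⊗ D) g`. The factors `1 / (r_i (r_i - 1))` are absorbed in the
normalization of the observations and of the representers. -/
lemma cost_tensorInv (hp : 1 < p) (η : ℝ) (h : L2SS) :
    cost D r η w u (tensorInv D h) = (4 * Real.pi) ^ 2 / n *
      ∑ a, (obsVec r w a - inner ℝ h (dataFeature D r u a)) ^ 2 + η * ‖h‖ ^ 2 := by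
  rw [cost, tensorOp_tensorInv, Fintype.sum_sigma]
  congr 2
  refine Finset.sum_congr rfl fun i _ => ?_
  rw [Finset.mul_sum]
  refine Finset.sum_congr rfl fun jk _ => ?_
  have h1 := scale_sq (r := r) ⟨i, jk⟩
  have h2 := (scale_pos (r := r) ⟨i, jk⟩).ne'
  rw [contRep_tensorInv hp, dataFeature, real_inner_smul_right, obsVec]
  dsimp only at h1
  rw [← h1]
  simp only [dataPoint]
  field_simp

/-- The coefficients of a spline are determined by the spline: a combination of representers that is
orthogonal to all of them vanishes, and its Fourier coefficients are a combination of evaluations at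
distinct points. -/
lemma splineForm_injective (hp : 1 < p)
    (hu : Function.Injective fun a : (i : Fin n) × Fin (r i) => u a.1 a.2) {β β' : OffDiag r → ℝ}
    (h : ∀ x y, splineForm r u (greenKer D) β x y = splineForm r u (greenKer D) β' x y) :
    β = β' := by
  set s := ∑ a, (β a - β' a) • dataFeature D r u a with hs
  have h1 : ∀ x, inner ℝ s (feature D x) = 0 := fun x => by
    have h2 := h x.1 x.2
    rw [splineForm_eq D hp, splineForm_eq D hp, ← sub_eq_zero, ← inner_sub_left,
      ← Finset.sum_sub_distrib] at h2
    simpa only [hs, sub_smul] using h2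
  have h0 : s = 0 := by
    have h3 : inner ℝ s s = 0 := by
      nth_rewrite 2 [hs]
      rw [inner_sum]
      refine Finset.sum_eq_zero fun a _ => ?_
      rw [real_inner_smul_right, dataFeature, real_inner_smul_right, h1, mul_zero, mul_zero]
    exact inner_self_eq_zero.mp h3
  have h4 : (fun a => (β a - β' a) / scale r a) = 0 := by
    refine eq_zero_of_sum_harm₂ (dataPoint_injective hu) fun k => ?_
    have h5 : inner ℝ s (YY k) * D.tensorCoeff k = 0 := by rw [h0, inner_zero_left, zero_mul]
    rw [← h5, hs, sum_inner, Finset.sum_mul]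
    refine Finset.sum_congr rfl fun a _ => ?_
    rw [real_inner_smul_left, dataFeature, real_inner_smul_left, inner_feature_YY hp]
    have := D.tensorCoeff_ne_zero k
    field_simp
  funext a
  have h6 := congrFun h4 a
  exact sub_eq_zero.mp ((div_eq_zero_iff.mp h6).resolve_right (scale_pos a).ne')

/-- The exchange of `j` and `k`. -/
def swapIdx (r : Fin n → ℕ) : OffDiag r ≃ OffDiag r :=
  Equiv.sigmaCongrRight fun i =>
    (Equiv.prodComm (Fin (r i)) (Fin (r i))).subtypeEquiv fun _ => ne_comm

lemma splineForm_swap (ψ : C(Set.Icc (-1 : ℝ) 1, ℝ)) (β : OffDiag r → ℝ) (x y : S2) :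
    splineForm r u ψ β x y = splineForm r u ψ (β ∘ swapIdx r) y x := by
  refine Finset.sum_congr rfl fun i _ => congrArg _ ?_
  refine Fintype.sum_equiv
    ((Equiv.prodComm (Fin (r i)) (Fin (r i))).subtypeEquiv fun _ => ne_comm) _ _ fun jk => ?_
  exact congrArg (β ⟨i, jk⟩ * ·) (mul_comm _ _)

/-- The linear system for the coefficients is invariant under the exchange of `j` and `k`. -/
lemma coeff_swap (ψ : C(Set.Icc (-1 : ℝ) 1, ℝ)) (lam : ℝ) :
    ((gram r u ψ + lam • (1 : Matrix (OffDiag r) (OffDiag r) ℝ))⁻¹.mulVec (obsVec r w)) ∘ swapIdx r =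
      (gram r u ψ + lam • (1 : Matrix (OffDiag r) (OffDiag r) ℝ))⁻¹.mulVec (obsVec r w) := by
  set M := gram r u ψ + lam • (1 : Matrix (OffDiag r) (OffDiag r) ℝ) with hM
  have h1 : M.submatrix (swapIdx r) (swapIdx r) = M := by
    ext a b
    have hg : gram r u ψ (swapIdx r a) (swapIdx r b) = gram r u ψ a b :=
      congrArg (· / _) (mul_comm _ _)
    simp only [hM, Matrix.submatrix_apply, Matrix.add_apply, Matrix.smul_apply, hg,
      Matrix.one_apply, (swapIdx r).injective.eq_iff]
  have h2 : M⁻¹.submatrix (swapIdx r) (swapIdx r) = M⁻¹ := by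
    rw [← Matrix.inv_submatrix_equiv, h1]
  have h3 : obsVec r w ∘ swapIdx r = obsVec r w := by
    funext a
    exact congrArg (· / scale r a) (mul_comm _ _)
  conv_rhs => rw [← h2, Matrix.submatrix_mulVec_equiv]
  funext a
  simp only [Function.comp_apply]
  congr 2
  exact (Equiv.eq_comp_symm (swapIdx r) _ _).mpr h3

end Problem

end SphereRep

end

theorem theorem4p2 {p : ℝ} (hp : 1 < p) (D : SphereRep.AdmissibleOperator p)
    {n : ℕ} (hn : 1 ≤ n) (r : Fin n → ℕ) (hr : ∀ i, 1 ≤ r i)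
    (w : (i : Fin n) → Fin (r i) → ℝ) (u : (i : Fin n) → Fin (r i) → SphereRep.S2)
    (hu : Function.Injective fun a : (i : Fin n) × Fin (r i) => u a.1 a.2)
    (η : ℝ) (hη : 0 < η) :
    -- The problem is meaningful: point values and `(D ⊗ D) g` are well defined.
    (∀ g ∈ SphereRep.sobolevSS p,
      (∃! c : C(SphereRep.S2 × SphereRep.S2, ℝ), SphereRep.clsSS c = g) ∧
      Summable (D.tensorTerm g)) ∧
    -- The zonal Green's kernel of `D* D` exists and is unique.
    ∃ ψ : C(Set.Icc (-1 : ℝ) 1, ℝ),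
      SphereRep.IsZonalGreenKernel (D.adjoint.comp D) ψ ∧
      (∀ ψ', SphereRep.IsZonalGreenKernel (D.adjoint.comp D) ψ' → ψ' = ψ) ∧
      -- The linear system for the coefficients is invertible.
      IsUnit (SphereRep.gram r u ψ +
        (η * n / (4 * Real.pi) ^ 2) • (1 : Matrix (SphereRep.OffDiag r) (SphereRep.OffDiag r) ℝ)) ∧
      ∃ R ∈ SphereRep.sobolevSS p,
        -- `R` is the unique solution.
        IsMinOn (SphereRep.cost D r η w u) (SphereRep.sobolevSS p) R ∧
        (∀ g ∈ SphereRep.sobolevSS p,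
          IsMinOn (SphereRep.cost D r η w u) (SphereRep.sobolevSS p) g → g = R) ∧
        -- Its form and its coefficients.
        (∀ β : SphereRep.OffDiag r → ℝ,
          (∀ x y, SphereRep.contRep R (x, y) = SphereRep.splineForm r u ψ β x y) ↔
          β = (SphereRep.gram r u ψ + (η * n / (4 * Real.pi) ^ 2) •
            (1 : Matrix (SphereRep.OffDiag r) (SphereRep.OffDiag r) ℝ))⁻¹.mulVec
              (SphereRep.obsVec r w)) ∧
        -- Symmetry.
        ∀ x y, SphereRep.contRep R (x, y) = SphereRep.contRep R (y, x) := by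
  have hlam : 0 < η * n / (4 * Real.pi) ^ 2 := by positivity
  have hn0 : (n : ℝ) ≠ 0 := by positivity
  have hc : 0 < (4 * Real.pi) ^ 2 / (n : ℝ) := by positivity
  have hcl : (4 * Real.pi) ^ 2 / (n : ℝ) * (η * n / (4 * Real.pi) ^ 2) = η := by
    have := Real.pi_ne_zero
    field_simp
  have hunit := SphereRep.isUnit_gram_add_smul (SphereRep.dataFeature D r u) hlam
  rw [← SphereRep.gram_eq D hp] at hunit
  refine ⟨fun g hg => ⟨?_, (SphereRep.hasSum_tensorTerm D hg).1.summable⟩,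
    SphereRep.greenKer D, SphereRep.isZonalGreenKernel_greenKer hp D,
    fun ψ' h => SphereRep.eq_of_isZonalGreenKernel h (SphereRep.isZonalGreenKernel_greenKer hp D),
    hunit, ?_⟩
  · obtain ⟨c, h1, -⟩ := SphereRep.exists_clsSS_eq hp D hg
    exact ⟨c, h1, fun c' h' => SphereRep.clsSS_injective (h'.trans h1.symm)⟩
  -- the normal equations and the resulting minimizer
  set M := SphereRep.gram r u (SphereRep.greenKer D) + (η * n / (4 * Real.pi) ^ 2) •
    (1 : Matrix (SphereRep.OffDiag r) (SphereRep.OffDiag r) ℝ) with hM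
  set β := M⁻¹.mulVec (SphereRep.obsVec r w) with hβ
  have hMβ : M.mulVec β = SphereRep.obsVec r w := by
    rw [hβ, Matrix.mulVec_mulVec, Matrix.mul_nonsing_inv _ ((Matrix.isUnit_iff_isUnit_det _).mp hunit),
      Matrix.one_mulVec]
  set s := ∑ a, β a • SphereRep.dataFeature D r u a with hs
  have hid := SphereRep.ridge_identity (SphereRep.dataFeature D r u) (SphereRep.obsVec r w) β hcl
    (by rw [← SphereRep.gram_eq D hp]; exact hMβ)
  rw [← hs] at hid
  have hrep : ∀ x y, SphereRep.contRep (SphereRep.tensorInv D s) (x, y)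
      = SphereRep.splineForm r u (SphereRep.greenKer D) β x y := fun x y => by
    rw [SphereRep.contRep_tensorInv hp, SphereRep.splineForm_eq D hp]
  -- the excess of the cost at `g` over the cost at the minimizer
  have hcost : ∀ g ∈ SphereRep.sobolevSS p, SphereRep.cost D r η w u (SphereRep.tensorInv D s)
      + η * ‖D.tensorOp g - s‖ ^ 2 ≤ SphereRep.cost D r η w u g := fun g hg => by
    have h1 := SphereRep.cost_tensorInv D w (u := u) hp η (D.tensorOp g)
    rw [SphereRep.tensorInv_tensorOp D hg, hid, ← SphereRep.cost_tensorInv D w hp η s] at h1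
    rw [h1]
    have : 0 ≤ (4 * Real.pi) ^ 2 / (n : ℝ) *
        ∑ a, (inner ℝ (D.tensorOp g - s) (SphereRep.dataFeature D r u a)) ^ 2 :=
      mul_nonneg hc.le (Finset.sum_nonneg fun a _ => sq_nonneg _)
    linarith
  refine ⟨SphereRep.tensorInv D s, SphereRep.tensorInv_mem D s, ?_, ?_, ?_, ?_⟩
  · rw [isMinOn_iff]
    intro g hg
    have := hcost g hg
    have : 0 ≤ η * ‖D.tensorOp g - s‖ ^ 2 := by positivity
    linarith
  · intro g hg hmin
    have h1 := hcost g hg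
    have h2 := isMinOn_iff.mp hmin _ (SphereRep.tensorInv_mem D s)
    have h3 : ‖D.tensorOp g - s‖ ^ 2 ≤ 0 := by
      by_contra! h
      have := mul_pos hη h
      linarith
    have h4 : D.tensorOp g = s :=
      sub_eq_zero.mp (norm_eq_zero.mp (by simpa using le_antisymm h3 (sq_nonneg _)))
    rw [← h4, SphereRep.tensorInv_tensorOp D hg]
  · intro β'
    constructor
    · intro h
      exact SphereRep.splineForm_injective D hp hu fun x y => (h x y).symm.trans (hrep x y)
    · rintro rfl
      exact hrep
  · intro x y
    rw [hrep, hrep, SphereRep.splineForm_swap, hβ, hM, SphereRep.coeff_swap]
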